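/- **Setting.** Call a morphism *surjective* (written $\twoheadrightarrow$) if it factors through no proper subobject of its target, and *injective* if it is a monomorphism. A category $\mathcal A$ is *regular* if every morphism has an image (a least subobject of the target through which it factors), there is a terminal object, the pullback of a cospan exists whenever the cospan can be completed to a commutative square, and pullbacks of surjective morphisms along arbitrary morphisms exist and are surjective. It is *subobject finite* if each object has finitely many subobjects, *Mal'tsev* if every relation $r\subseteq x\times x$ containing the diagonal is an equivalence relation, and *exact* if every equivalence relation $r\subseteq x\times x$ is of the form $r=x\times_yx$ for a surjective morphism $x\twoheadrightarrow y$. A *degree function* $\delta$ on $\mathcal A$ with values in a commutative ring $K$ assigns to each surjective morphism $e$ an element $\delta(e)\in K$ such that $\delta(\mathrm{id}_x)=1$, $\delta(\bar e)=\delta(e)$ whenever $\bar e$ is a pullback of $e$, and $\delta(e\bar e)=\delta(e)\delta(\bar e)$ for composable $e,\bar e$. The category $\mathcal T^0=\mathcal T^0(\mathcal A,\delta)$ has an object $[x]$ for every object $x$ of $\mathcal A$; the morphisms $[x]\to[y]$ are the formal $K$-linear combinations of relations $\langle r\rangle$, i.e. of isomorphism classes of jointly injective pairs $x\leftarrow r\to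 y$, with bilinear composition $\langle s\rangle\langle r\rangle=\delta(r\times_ys\twoheadrightarrow s\circ r)\,\langle s\circ r\rangle$, where $s\circ r$ is the image of $r\times_ys$ in $x\times z$, and $\langle s\rangle\langle r\rangle=0$ if $r\times_ys$ does not exist. Let $\mathcal T$ be the pseudo-abelian closure of $\mathcal T^0$. For $f:x\to y$ let $[f]:[x]\to[y]$ be given by the graph of $f$ and $[f]^\vee:[y]\to[x]$ by its transpose. For a subobject $i:u\hookrightarrow x$ put $p_u=[i][i]^\vee$, let $p_x^*=\sum_{u\subseteq x}\mu(u,x)p_u$, where $\mu$ is the Möbius function of the poset of subobjects of $x$ (this is an idempotent), and let $[x]^*=p_x^*[x]$ be the corresponding direct summand of $[x]$ in $\mathcal T$. For a surjective $e:x\twoheadrightarrow y$ put $$\omega_e=\sum_{u\subseteq x,\ e(u)=y}\mu(u,x)\,\delta(u\twoheadrightarrow y)\in K .$$ A *co-relation* between $x$ and $y$ is an isomorphism class of diagrams $x\twoheadrightarrow u\twoheadleftarrow y$. Write $R_Q(x,y)$ for the set of co-relations, partially ordered by $u\le v$ if $x,y\twoheadrightarrow v$ factors through $x,y\twoheadrightarrow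 u$; it is finite if $\mathcal A$ is subobject finite, and $\mu_Q$ denotes its Möbius function. For $u\in R_Q(x,y)$ with legs $a:x\twoheadrightarrow u$ and $b:y\twoheadrightarrow u$ put $$\{u\}'=p_y^*\,[b]^\vee[a]\,p_x^*:\ [x]^*\to[y]^* .$$ **Lemma.** Let $\mathcal A$ be a subobject finite, exact Mal'tsev regular category, and let $\delta$ be a degree function on $\mathcal A$ with values in a commutative ring $K$. Let $u\in R_Q(x,y)$ and $v\in R_Q(y,z)$, and let $\bar y$ be the image of $y$ in $u\times v$. Then the pushout $w=u\sqcup_yv$ exists, the morphisms $u\to w$ and $v\to w$ are surjective (so that $w\in R_Q(u,v)$), $\bar y=u\times_wv$, and $$\{v\}'\,\{u\}'=\omega_{y\twoheadrightarrow\bar y}\sum_{t\in R_Q(u,v),\ t\le w}\mu_Q(t,w)\,\{t\}' ,$$ where on the right $t$ is regarded as an element of $R_Q(x,z)$ via $x\twoheadrightarrow u\twoheadrightarrow t\twoheadleftarrow v\twoheadleftarrow z$. -/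

import Mathlib

open CategoryTheory CategoryTheory.Limits

universe v u w

namespace TensorEnvelope

/-! ### Regular categories -/

section Basic

variable {A : Type u} [Category.{v} A]

/-- A morphism is surjective (an extremal epimorphism) if its image is the whole target, i.e.
every subobject of the target through which it factors is the target itself. -/
def Surj {x y : A} (f : x ⟶ y) : Prop :=
  ∀ ⦃z : A⦄ (g : x ⟶ z) (m : z ⟶ y) [Mono m], g ≫ m = f → IsIso m

variable (A) in
/-- A regular category: images exist, there is a terminal object, the pullback of a cospan exists
as soon as the cospan can be completed to a commutative square, and the pullback of a surjective
morphism along an arbitrary morphism exists and is surjective. Pullbacks are not required to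
exist in general. -/
class RegularCat : Prop where
  exists_image : ∀ {x y : A} (f : x ⟶ y), ∃ S : Subobject y, IsLeast {S | S.Factors f} S
  hasTerminal : HasTerminal A
  hasPullback : ∀ {u x y z : A} (p : u ⟶ x) (q : u ⟶ y) (f : x ⟶ z) (g : y ⟶ z),
    p ≫ f = q ≫ g → HasPullback f g
  surj_pullback : ∀ {x y z : A} (f : x ⟶ z) (g : y ⟶ z), Surj f →
    ∃ (r : A) (p : r ⟶ x) (q : r ⟶ y), IsPullback p q f g ∧ Surj q

/-- A pair of morphisms with a common source that is jointly injective. -/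
def JointlyMono {r x y : A} (p : r ⟶ x) (q : r ⟶ y) : Prop :=
  ∀ ⦃t : A⦄ (f g : t ⟶ r), f ≫ p = g ≫ p → f ≫ q = g ≫ q → f = g

/-! ### Relations -/

variable (A) in
/-- Representatives of relations between `x` and `y`: jointly injective pairs `x ← r → y`,
that is, monomorphisms into the product of `x` and `y` (whose existence is thus not needed
to speak about relations). -/
structure MonoSpan (x y : A) where
  obj : A
  fst : obj ⟶ x
  snd : obj ⟶ y
  jm : JointlyMono fst snd

/-- `r ≤ s` if `r` factors through `s`, as for monomorphisms into the product. -/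
instance (x y : A) : Preorder (MonoSpan A x y) where
  le r s := ∃ h : r.obj ⟶ s.obj, h ≫ s.fst = r.fst ∧ h ≫ s.snd = r.snd
  le_refl r := ⟨𝟙 _, by simp, by simp⟩
  le_trans r s t := by
    rintro ⟨h, h1, h2⟩ ⟨k, k1, k2⟩
    exact ⟨h ≫ k, by rw [Category.assoc, k1, h1], by rw [Category.assoc, k2, h2]⟩

/-- Relations between `x` and `y`, i.e. subobjects of the product of `x` and `y`: equivalence
classes of jointly injective pairs, with the induced partial order. -/
abbrev Rel (x y : A) : Type max u v := Antisymmetrization (MonoSpan A x y) (· ≤ ·)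

/-- The relation represented by a jointly injective pair. -/
abbrev MonoSpan.toRel {x y : A} (r : MonoSpan A x y) : Rel x y := toAntisymmetrization (· ≤ ·) r

/-- A chosen representative of a relation. -/
noncomputable abbrev Rel.rep {x y : A} (r : Rel x y) : MonoSpan A x y :=
  ofAntisymmetrization (· ≤ ·) r

/-- The relation given by the jointly injective pair `p, q : r ⟶ x` is an equivalence relation:
it is so on generalized elements. -/
def IsEquivRel {r x : A} (p q : r ⟶ x) : Prop :=
  JointlyMono p q ∧
    ∀ t : A, Equivalence fun f g : t ⟶ x => ∃ h : t ⟶ r, h ≫ p = f ∧ h ≫ q = g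

variable (A) in
/-- Every relation on an object `x` that contains the diagonal is an equivalence relation. -/
class Maltsev : Prop where
  isEquivRel : ∀ {x : A} (r : MonoSpan A x x),
    (∃ d : x ⟶ r.obj, d ≫ r.fst = 𝟙 x ∧ d ≫ r.snd = 𝟙 x) → IsEquivRel r.fst r.snd

variable (A) in
/-- Every equivalence relation is the kernel pair of a surjective morphism. -/
class ExactCat : Prop where
  exists_quotient : ∀ {r x : A} (p q : r ⟶ x), IsEquivRel p q →
    ∃ (y : A) (e : x ⟶ y), Surj e ∧ IsPullback p q e e

variable (A) in
/-- Every object has only finitely many subobjects. -/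
class SubobjectFinite : Prop where
  finite : ∀ x : A, Finite (Subobject x)

instance [SubobjectFinite A] (x : A) : Finite (Subobject x) := SubobjectFinite.finite x

lemma Surj.of_isIso {x y : A} (f : x ⟶ y) [IsIso f] : Surj f := by
  intro z g m _ h
  have : IsSplitEpi m := ⟨⟨⟨inv f ≫ g, by simp [h]⟩⟩⟩
  exact isIso_of_mono_of_isSplitEpi m

lemma Surj.id (x : A) : Surj (𝟙 x) := Surj.of_isIso _

lemma Surj.of_comp {x y z : A} {f : x ⟶ y} {g : y ⟶ z} (h : Surj (f ≫ g)) : Surj g := by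
  intro t k m _ hk
  exact h (f ≫ k) m (by simp [hk])

variable [RegularCat A]

instance : HasTerminal A := RegularCat.hasTerminal

lemma exists_isPullback {t x y z : A} {p : t ⟶ x} {q : t ⟶ y} {f : x ⟶ z} {g : y ⟶ z}
    (h : p ≫ f = q ≫ g) :
    ∃ (r : A) (a : r ⟶ x) (b : r ⟶ y) (k : t ⟶ r), IsPullback a b f g ∧ k ≫ a = p ∧ k ≫ b = q := by
  have := RegularCat.hasPullback p q f g h
  exact ⟨_, _, _, pullback.lift p q h, IsPullback.of_hasPullback f g,
    pullback.lift_fst _ _ _, pullback.lift_snd _ _ _⟩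

lemma Surj.lift_mono {t x y z : A} {e : t ⟶ x} (he : Surj e) (m : y ⟶ z) [Mono m]
    (f : x ⟶ z) (g : t ⟶ y) (h : e ≫ f = g ≫ m) : ∃ k : x ⟶ y, k ≫ m = f := by
  obtain ⟨r, a, b, k, hp, h1, h2⟩ := exists_isPullback h
  have : Mono a := hp.mono_fst_of_mono
  have := he k a h1
  exact ⟨inv a ≫ b, by rw [Category.assoc, ← hp.w]; simp⟩

lemma hasBinaryProduct_of_cone {t x y : A} (p : t ⟶ x) (q : t ⟶ y) : HasBinaryProduct x y := by
  obtain ⟨r, a, b, k, hp, -, -⟩ := exists_isPullback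
    (show p ≫ terminal.from x = q ≫ terminal.from y from Subsingleton.elim _ _)
  exact HasLimit.mk ⟨BinaryFan.mk a b, isProductOfIsTerminalIsPullback
    (terminal.from x) (terminal.from y) a b terminalIsTerminal hp.isLimit⟩

lemma Surj.epi {x y : A} {f : x ⟶ y} (hf : Surj f) : Epi f := by
  refine ⟨fun {z} p q h => ?_⟩
  have := hasBinaryProduct_of_cone (𝟙 z) (𝟙 z)
  obtain ⟨k, hk⟩ := hf.lift_mono (prod.lift (𝟙 z) (𝟙 z)) (prod.lift p q) (f ≫ p)
    (by ext <;> simp [h])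
  have h1 := congr($hk ≫ prod.fst)
  have h2 := congr($hk ≫ prod.snd)
  simp only [Category.assoc, prod.lift_fst, prod.lift_snd] at h1 h2
  rw [← h1, ← h2]

lemma Surj.comp {x y z : A} {f : x ⟶ y} {g : y ⟶ z} (hf : Surj f) (hg : Surj g) :
    Surj (f ≫ g) := by
  intro t k m _ hk
  obtain ⟨l, hl⟩ := hf.lift_mono m g k hk.symm
  exact hg l m hl

lemma Surj.of_isPullback {r x y z : A} {p : r ⟶ x} {q : r ⟶ y} {f : x ⟶ z} {g : y ⟶ z}
    (h : IsPullback p q f g) (hf : Surj f) : Surj q := by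
  obtain ⟨r', p', q', h', hq⟩ := RegularCat.surj_pullback f g hf
  have : q = (h.isoIsPullback _ _ h').hom ≫ q' := by simp
  rw [this]
  exact (Surj.of_isIso _).comp hq

/-- The universal property of surjections against jointly injective pairs. -/
lemma Surj.lift_jm {t i j x y : A} {e : t ⟶ i} (he : Surj e) {a : i ⟶ x} {b : i ⟶ y}
    {c : j ⟶ x} {d : j ⟶ y} (hj : JointlyMono c d) (g : t ⟶ j) (h1 : g ≫ c = e ≫ a)
    (h2 : g ≫ d = e ≫ b) : ∃ k : i ⟶ j, k ≫ c = a ∧ k ≫ d = b := by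
  have := hasBinaryProduct_of_cone a b
  have : Mono (prod.lift c d) := ⟨fun f g h => hj f g
    (by simpa [prod.lift_fst] using h =≫ prod.fst) (by simpa [prod.lift_snd] using h =≫ prod.snd)⟩
  obtain ⟨k, hk⟩ := he.lift_mono (prod.lift c d) (prod.lift a b) g (by ext <;> simp [h1, h2])
  exact ⟨k, by simpa [prod.lift_fst] using hk =≫ prod.fst, by simpa [prod.lift_snd] using hk =≫ prod.snd⟩

lemma exists_factor {x y : A} (f : x ⟶ y) :
    ∃ (i : A) (e : x ⟶ i) (m : i ⟶ y), Surj e ∧ Mono m ∧ e ≫ m = f := by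
  obtain ⟨S, hS, hmin⟩ := RegularCat.exists_image f
  refine ⟨_, S.factorThru f hS, S.arrow, ?_, inferInstance, by simp⟩
  intro z g m _ h
  have h1 : S ≤ Subobject.mk (m ≫ S.arrow) := hmin
    ((Subobject.factors_iff _ _).2 ⟨g ≫ (Subobject.underlyingIso (m ≫ S.arrow)).inv, by
      change (g ≫ _) ≫ (Subobject.mk (m ≫ S.arrow)).arrow = f
      simp only [Category.assoc, Subobject.underlyingIso_arrow]
      rw [← Category.assoc, h]; simp⟩)
  have : IsSplitEpi m := by
    refine ⟨⟨⟨Subobject.ofLEMk S (m ≫ S.arrow) h1, ?_⟩⟩⟩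
    rw [← cancel_mono S.arrow]
    simp
  exact isIso_of_mono_of_isSplitEpi m

/-- The image of the pair `x ← t → y` induced by `f` and `g`, i.e. the image of `t` in the product
of `x` and `y`. -/
lemma exists_spanImage {t x y : A} (f : t ⟶ x) (g : t ⟶ y) :
    ∃ (r : MonoSpan A x y) (e : t ⟶ r.obj), Surj e ∧ e ≫ r.fst = f ∧ e ≫ r.snd = g := by
  have := hasBinaryProduct_of_cone f g
  obtain ⟨i, e, m, he, hm, h⟩ := exists_factor (prod.lift f g)
  refine ⟨⟨i, m ≫ prod.fst, m ≫ prod.snd, fun t a b h1 h2 => ?_⟩, e, he, ?_, ?_⟩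
  · rw [← cancel_mono m]
    ext <;> simpa
  · simpa [prod.lift_fst] using h =≫ prod.fst
  · simpa [prod.lift_snd] using h =≫ prod.snd

/-- The image in the product of `x` and `y` of an object `t` equipped with morphisms to
`x` and `y`. -/
noncomputable def spanImage {t x y : A} (f : t ⟶ x) (g : t ⟶ y) : MonoSpan A x y :=
  (exists_spanImage f g).choose

/-- The surjection of an object onto its image in the product. -/
noncomputable def toSpanImage {t x y : A} (f : t ⟶ x) (g : t ⟶ y) : t ⟶ (spanImage f g).obj :=
  (exists_spanImage f g).choose_spec.choose

lemma toSpanImage_surj {t x y : A} (f : t ⟶ x) (g : t ⟶ y) : Surj (toSpanImage f g) :=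
  (exists_spanImage f g).choose_spec.choose_spec.1

lemma toSpanImage_fst {t x y : A} (f : t ⟶ x) (g : t ⟶ y) :
    toSpanImage f g ≫ (spanImage f g).fst = f :=
  (exists_spanImage f g).choose_spec.choose_spec.2.1

lemma toSpanImage_snd {t x y : A} (f : t ⟶ x) (g : t ⟶ y) :
    toSpanImage f g ≫ (spanImage f g).snd = g :=
  (exists_spanImage f g).choose_spec.choose_spec.2.2

end Basic

/-! ### Degree functions -/

/-- A degree function on `A` with values in `K`. -/
structure DegreeFunction (A : Type u) [Category.{v} A] (K : Type w) [CommRing K] where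
  deg : ∀ {x y : A} (e : x ⟶ y), Surj e → K
  deg_id : ∀ (x : A) (h : Surj (𝟙 x)), deg (𝟙 x) h = 1
  deg_pullback : ∀ {r x y z : A} {p : r ⟶ x} {q : r ⟶ y} {f : x ⟶ z} {g : y ⟶ z},
    IsPullback p q f g → ∀ (hf : Surj f) (hq : Surj q), deg q hq = deg f hf
  deg_comp : ∀ {x y z : A} (f : x ⟶ y) (g : y ⟶ z) (hf : Surj f) (hg : Surj g)
    (hfg : Surj (f ≫ g)), deg (f ≫ g) hfg = deg f hf * deg g hg

section T0

variable {A : Type u} [Category.{v} A] {K : Type w} [CommRing K]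

lemma DegreeFunction.deg_iso (δ : DegreeFunction A K) {x y : A} (f : x ⟶ y) [IsIso f]
    (h : Surj f) : δ.deg f h = 1 := by
  rw [← δ.deg_id y (Surj.id y)]
  exact δ.deg_pullback (IsPullback.of_vert_isIso (fst := f) (f := 𝟙 y) (g := 𝟙 y) ⟨by simp⟩) _ _

variable [RegularCat A] (δ : DegreeFunction A K)

/-- The multiple `δ (t ↠ i) ⟨i⟩` of the basis element of the image `i` of `t` in the product of
`x` and `y`. -/
noncomputable def spanHom {t x y : A} (f : t ⟶ x) (g : t ⟶ y) : Rel x y →₀ K :=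
  Finsupp.single (spanImage f g).toRel (δ.deg (toSpanImage f g) (toSpanImage_surj f g))

open Classical in
/-- The product of the basis elements of two relations `r` and `s`: it is
`δ (r ×_y s ↠ s ∘ r) ⟨s ∘ r⟩` if the fibre product `r ×_y s` exists, where `s ∘ r` is its image in
the product of `x` and `z`, and zero otherwise. -/
noncomputable def relComp {x y z : A} (r : Rel x y) (s : Rel y z) : Rel x z →₀ K :=
  if _h : HasPullback r.rep.snd s.rep.fst then
    spanHom δ (pullback.fst r.rep.snd s.rep.fst ≫ r.rep.fst)
      (pullback.snd r.rep.snd s.rep.fst ≫ s.rep.snd)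
  else 0

/-- The bilinear extension of `relComp` to linear combinations of relations. -/
noncomputable def compHom (x y z : A) :
    (Rel x y →₀ K) →ₗ[K] (Rel y z →₀ K) →ₗ[K] (Rel x z →₀ K) :=
  Finsupp.linearCombination K fun r => Finsupp.linearCombination K fun s => relComp δ r s

lemma compHom_single {x y z : A} (r : Rel x y) (s : Rel y z) (k l : K) :
    compHom δ x y z (Finsupp.single r k) (Finsupp.single s l) = (k * l) • relComp δ r s := by
  simp [compHom, mul_smul]

lemma spanHom_eq_single {t x y : A} (r : MonoSpan A x y) (e : t ⟶ r.obj) (he : Surj e) :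
    spanHom δ (e ≫ r.fst) (e ≫ r.snd) = Finsupp.single r.toRel (δ.deg e he) := by
  have h1 := toSpanImage_fst (e ≫ r.fst) (e ≫ r.snd)
  have h2 := toSpanImage_snd (e ≫ r.fst) (e ≫ r.snd)
  have hs := toSpanImage_surj (e ≫ r.fst) (e ≫ r.snd)
  change Finsupp.single (spanImage (e ≫ r.fst) (e ≫ r.snd)).toRel
    (δ.deg (toSpanImage (e ≫ r.fst) (e ≫ r.snd)) hs) = _
  generalize toSpanImage (e ≫ r.fst) (e ≫ r.snd) = e' at *
  generalize spanImage (e ≫ r.fst) (e ≫ r.snd) = r' at *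
  obtain ⟨k, k1, k2⟩ := he.lift_jm r'.jm e' h1 h2
  obtain ⟨l, l1, l2⟩ := hs.lift_jm r.jm e h1.symm h2.symm
  have hkl : k ≫ l = 𝟙 _ := r.jm _ _ (by simp [*]) (by simp [*])
  have hlk : l ≫ k = 𝟙 _ := r'.jm _ _ (by simp [*]) (by simp [*])
  have : IsIso k := ⟨l, hkl, hlk⟩
  have hek : e ≫ k = e' := r'.jm _ _ (by simp [*]) (by simp [*])
  have hr : r'.toRel = r.toRel := Quotient.sound ⟨⟨l, l1, l2⟩, ⟨k, k1, k2⟩⟩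
  subst hek
  rw [hr, δ.deg_comp e k he (Surj.of_isIso k), δ.deg_iso k, mul_one]

lemma spanHom_mono {x y : A} (r : MonoSpan A x y) :
    spanHom δ r.fst r.snd = Finsupp.single r.toRel 1 := by
  have := spanHom_eq_single δ r (𝟙 _) (Surj.id _)
  rwa [Category.id_comp, Category.id_comp, δ.deg_id] at this

/-- Every pair of morphisms factors through the chosen representative of its image. -/
lemma exists_rep {t x y : A} (f : t ⟶ x) (g : t ⟶ y) :
    ∃ (R : Rel x y) (e : t ⟶ R.rep.obj) (he : Surj e), e ≫ R.rep.fst = f ∧ e ≫ R.rep.snd = g ∧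
      spanHom δ f g = Finsupp.single R (δ.deg e he) := by
  obtain ⟨r, e, he, rfl, rfl⟩ := exists_spanImage f g
  have hr : (r.toRel.rep).toRel = r.toRel := toAntisymmetrization_ofAntisymmetrization _ _
  obtain ⟨⟨l, l1, l2⟩, ⟨k, k1, k2⟩⟩ := Quotient.exact hr
  have hkl : k ≫ l = 𝟙 _ := r.jm _ _ (by simp [*]) (by simp [*])
  have hlk : l ≫ k = 𝟙 _ := r.toRel.rep.jm _ _ (by simp [*]) (by simp [*])
  have : IsIso k := ⟨l, hkl, hlk⟩
  refine ⟨r.toRel, e ≫ k, he.comp (Surj.of_isIso k), by simp [*], by simp [*], ?_⟩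
  rw [spanHom_eq_single δ r e he, δ.deg_comp e k he (Surj.of_isIso k), δ.deg_iso k, mul_one]

lemma pullback_map_surj {t t' r s y p₁ p₂ : A} {e : t ⟶ r} {e' : t' ⟶ s} (he : Surj e)
    (he' : Surj e') {b : r ⟶ y} {c : s ⟶ y} {p : p₁ ⟶ t} {q : p₁ ⟶ t'} {P : p₂ ⟶ r} {Q : p₂ ⟶ s}
    (h₁ : IsPullback p q (e ≫ b) (e' ≫ c)) (h₂ : IsPullback P Q b c) (m : p₁ ⟶ p₂)
    (hP : m ≫ P = p ≫ e) (hQ : m ≫ Q = q ≫ e') :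
    ∃ hm : Surj m, δ.deg m hm = δ.deg e he * δ.deg e' he' := by
  obtain ⟨M, i, j, hM, hj⟩ := RegularCat.surj_pullback e' Q he'
  -- `M` is the fibre product of `r` and `t'`
  have hM' : IsPullback (j ≫ P) i b (e' ≫ c) := hM.flip.paste_horiz h₂
  have hw : p ≫ e ≫ b = q ≫ e' ≫ c := h₁.w
  obtain ⟨n, n1, n2⟩ : ∃ n : p₁ ⟶ M, n ≫ (j ≫ P) = p ≫ e ∧ n ≫ i = q :=
    ⟨hM'.lift (p ≫ e) q (by simpa using hw), by simp, by simp⟩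
  have hn : IsPullback p n e (j ≫ P) := by
    refine IsPullback.of_bot ?_ n1.symm hM'
    rw [n2]; exact h₁
  have hns : Surj n := Surj.of_isPullback hn he
  have hnm : n ≫ j = m := h₂.hom_ext (by simp [n1, hP]) (by simp [← hM.w, hQ, ← n2])
  subst hnm
  refine ⟨hns.comp hj, ?_⟩
  rw [δ.deg_comp n j hns hj, δ.deg_pullback hn he, δ.deg_pullback hM he']

lemma spanHom_precomp {t' t x y : A} (e : t' ⟶ t) (he : Surj e) (f : t ⟶ x) (g : t ⟶ y) :
    spanHom δ (e ≫ f) (e ≫ g) = δ.deg e he • spanHom δ f g := by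
  obtain ⟨r, k, hk, rfl, rfl⟩ := exists_spanImage f g
  rw [← Category.assoc, ← Category.assoc, spanHom_eq_single δ r _ (he.comp hk),
    spanHom_eq_single δ r _ hk, δ.deg_comp e k he hk]
  simp

lemma compHom_spanHom {t t' x y z p₀ : A} (f : t ⟶ x) (g : t ⟶ y) (f' : t' ⟶ y) (g' : t' ⟶ z)
    {p : p₀ ⟶ t} {q : p₀ ⟶ t'} (h : IsPullback p q g f') :
    compHom δ x y z (spanHom δ f g) (spanHom δ f' g') = spanHom δ (p ≫ f) (q ≫ g') := by
  obtain ⟨R, e, he, rfl, rfl, h1⟩ := exists_rep δ f g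
  obtain ⟨S, e', he', rfl, rfl, h2⟩ := exists_rep δ f' g'
  have hp := RegularCat.hasPullback (p ≫ e) (q ≫ e') R.rep.snd S.rep.fst (by simpa using h.w)
  rw [h1, h2, compHom_single, relComp, dif_pos hp]
  obtain ⟨hm, hd⟩ := pullback_map_surj δ he he' h (IsPullback.of_hasPullback R.rep.snd S.rep.fst)
    (pullback.lift (p ≫ e) (q ≫ e') (by simpa using h.w))
    (pullback.lift_fst _ _ _) (pullback.lift_snd _ _ _)
  rw [← hd, ← spanHom_precomp]
  simp only [pullback.lift_fst_assoc, pullback.lift_snd_assoc, Category.assoc]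

lemma compHom_spanHom_zero {t t' x y z : A} (f : t ⟶ x) (g : t ⟶ y) (f' : t' ⟶ y) (g' : t' ⟶ z)
    (h : ¬ HasPullback g f') : compHom δ x y z (spanHom δ f g) (spanHom δ f' g') = 0 := by
  obtain ⟨R, e, he, rfl, rfl, h1⟩ := exists_rep δ f g
  obtain ⟨S, e', he', rfl, rfl, h2⟩ := exists_rep δ f' g'
  rw [h1, h2, compHom_single, relComp, dif_neg, smul_zero]
  intro hp
  apply h
  obtain ⟨M, i, j, hM, -⟩ := RegularCat.surj_pullback e (pullback.fst R.rep.snd S.rep.fst) he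
  obtain ⟨N, i', j', hN, -⟩ :=
    RegularCat.surj_pullback e' (j ≫ pullback.snd R.rep.snd S.rep.fst) he'
  refine RegularCat.hasPullback (j' ≫ i) i' _ _ ?_
  have := pullback.condition (f := R.rep.snd) (g := S.rep.fst)
  have h3 := hM.w
  have h4 := hN.w
  calc (j' ≫ i) ≫ e ≫ R.rep.snd = j' ≫ (i ≫ e) ≫ R.rep.snd := by simp
    _ = (j' ≫ j ≫ pullback.snd R.rep.snd S.rep.fst) ≫ S.rep.fst := by
      rw [h3, Category.assoc, Category.assoc, Category.assoc, this]
    _ = i' ≫ e' ≫ S.rep.fst := by rw [← h4]; simp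

lemma compHom_assoc_span {t₁ t₂ t₃ x y z w : A} (f₁ : t₁ ⟶ x) (g₁ : t₁ ⟶ y) (f₂ : t₂ ⟶ y)
    (g₂ : t₂ ⟶ z) (f₃ : t₃ ⟶ z) (g₃ : t₃ ⟶ w) :
    compHom δ x z w (compHom δ x y z (spanHom δ f₁ g₁) (spanHom δ f₂ g₂)) (spanHom δ f₃ g₃) =
      compHom δ x y w (spanHom δ f₁ g₁) (compHom δ y z w (spanHom δ f₂ g₂) (spanHom δ f₃ g₃)) := by
  by_cases h : ∃ (c : A) (c₁ : c ⟶ t₁) (c₂ : c ⟶ t₂) (c₃ : c ⟶ t₃),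
      c₁ ≫ g₁ = c₂ ≫ f₂ ∧ c₂ ≫ g₂ = c₃ ≫ f₃
  · obtain ⟨c, c₁, c₂, c₃, h1, h2⟩ := h
    obtain ⟨r, a, b, k, hr, hk1, hk2⟩ := exists_isPullback h1
    obtain ⟨s, a', b', k', hs, hk1', hk2'⟩ := exists_isPullback h2
    obtain ⟨m, a'', b'', k'', hm, -, -⟩ := exists_isPullback (hk2.trans hk1'.symm)
    rw [compHom_spanHom δ _ _ _ _ hr, compHom_spanHom δ _ _ _ _ hs,
      compHom_spanHom δ _ _ _ _ (hm.flip.paste_horiz hs.flip).flip,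
      compHom_spanHom δ _ _ _ _ (hm.paste_horiz hr)]
    simp
  · have hl : compHom δ x z w (compHom δ x y z (spanHom δ f₁ g₁) (spanHom δ f₂ g₂))
        (spanHom δ f₃ g₃) = 0 := by
      by_cases hp : HasPullback g₁ f₂
      · rw [compHom_spanHom δ _ _ _ _ (IsPullback.of_hasPullback g₁ f₂)]
        refine compHom_spanHom_zero δ _ _ _ _ fun hq => h ?_
        refine ⟨_, pullback.fst _ _ ≫ pullback.fst g₁ f₂, pullback.fst _ _ ≫ pullback.snd g₁ f₂,
          pullback.snd (pullback.snd g₁ f₂ ≫ g₂) f₃, ?_, ?_⟩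
        · simp [pullback.condition]
        · simpa using pullback.condition
      · rw [compHom_spanHom_zero δ _ _ _ _ hp]; simp
    have hr : compHom δ x y w (spanHom δ f₁ g₁)
        (compHom δ y z w (spanHom δ f₂ g₂) (spanHom δ f₃ g₃)) = 0 := by
      by_cases hp : HasPullback g₂ f₃
      · rw [compHom_spanHom δ _ _ _ _ (IsPullback.of_hasPullback g₂ f₃)]
        refine compHom_spanHom_zero δ _ _ _ _ fun hq => h ?_
        refine ⟨_, pullback.fst g₁ (pullback.fst g₂ f₃ ≫ f₂),
          pullback.snd _ _ ≫ pullback.fst g₂ f₃, pullback.snd _ _ ≫ pullback.snd g₂ f₃, ?_, ?_⟩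
        · simpa using pullback.condition
        · simp [pullback.condition]
      · rw [compHom_spanHom_zero δ _ _ _ _ hp]; simp
    rw [hl, hr]

/-- Linear combinations of relations are spanned by the elements `spanHom`. -/
lemma hom_induction {x y : A} {P : (Rel x y →₀ K) → Prop} (φ : Rel x y →₀ K) (h0 : P 0)
    (hadd : ∀ φ ψ, P φ → P ψ → P (φ + ψ)) (hsmul : ∀ (k : K) φ, P φ → P (k • φ))
    (hspan : ∀ {t : A} (f : t ⟶ x) (g : t ⟶ y), P (spanHom δ f g)) : P φ := by
  induction φ using Finsupp.induction_linear with
  | zero => exact h0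
  | add φ ψ h1 h2 => exact hadd _ _ h1 h2
  | single r k =>
    have : Finsupp.single r k = k • spanHom δ r.rep.fst r.rep.snd := by
      rw [spanHom_mono δ r.rep]
      simp [MonoSpan.toRel, Rel.rep]
    rw [this]
    exact hsmul _ _ (hspan _ _)

lemma compHom_assoc {x y z w : A} (φ : Rel x y →₀ K) (ψ : Rel y z →₀ K) (χ : Rel z w →₀ K) :
    compHom δ x z w (compHom δ x y z φ ψ) χ = compHom δ x y w φ (compHom δ y z w ψ χ) := by
  induction φ using hom_induction δ with
  | h0 => simp
  | hadd φ φ' h h' => simp [h, h']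
  | hsmul k φ h => simp [h]
  | hspan f g =>
    induction ψ using hom_induction δ with
    | h0 => simp
    | hadd φ φ' h h' => simp [h, h']
    | hsmul k φ h => simp [h]
    | hspan f' g' =>
      induction χ using hom_induction δ with
      | h0 => simp
      | hadd φ φ' h h' => simp [h, h']
      | hsmul k φ h => simp [h]
      | hspan f'' g'' => exact compHom_assoc_span δ _ _ _ _ _ _

/-- The graph of a morphism. -/
def graph {x y : A} (f : x ⟶ y) : MonoSpan A x y where
  obj := x
  fst := 𝟙 x
  snd := f
  jm _ _ _ h _ := by simpa using h

/-- The adjoint of the graph of a morphism. -/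
def graphAdj {x y : A} (f : x ⟶ y) : MonoSpan A y x where
  obj := x
  fst := f
  snd := 𝟙 x
  jm _ _ _ _ h := by simpa using h

lemma id_compHom {x y : A} (φ : Rel x y →₀ K) :
    compHom δ x x y (Finsupp.single (graph (𝟙 x)).toRel 1) φ = φ := by
  rw [← spanHom_mono δ]
  induction φ using hom_induction δ with
  | h0 => simp
  | hadd φ φ' h h' => simp [h, h']
  | hsmul k φ h => simp [h]
  | hspan f g =>
    exact (compHom_spanHom δ _ _ _ _ (IsPullback.id_horiz f).flip).trans (by simp [graph])

lemma compHom_id {x y : A} (φ : Rel x y →₀ K) :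
    compHom δ x y y φ (Finsupp.single (graph (𝟙 y)).toRel 1) = φ := by
  rw [← spanHom_mono δ]
  induction φ using hom_induction δ with
  | h0 => simp
  | hadd φ φ' h h' => simp [h, h']
  | hsmul k φ h => simp [h]
  | hspan f g =>
    exact (compHom_spanHom δ _ _ _ _ (IsPullback.id_horiz g)).trans (by simp [graph])

/-! ### The category `T⁰` -/

lemma compHom_add_left {x y z : A} (φ φ' : Rel x y →₀ K) (ψ : Rel y z →₀ K) :
    compHom δ x y z (φ + φ') ψ = compHom δ x y z φ ψ + compHom δ x y z φ' ψ := by simp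

lemma compHom_add_right {x y z : A} (φ : Rel x y →₀ K) (ψ ψ' : Rel y z →₀ K) :
    compHom δ x y z φ (ψ + ψ') = compHom δ x y z φ ψ + compHom δ x y z φ ψ' := by simp

lemma compHom_smul_left {x y z : A} (k : K) (φ : Rel x y →₀ K) (ψ : Rel y z →₀ K) :
    compHom δ x y z (k • φ) ψ = k • compHom δ x y z φ ψ := by simp

lemma compHom_smul_right {x y z : A} (φ : Rel x y →₀ K) (k : K) (ψ : Rel y z →₀ K) :
    compHom δ x y z φ (k • ψ) = k • compHom δ x y z φ ψ := by simp

/-- The objects of the category `T⁰` attached to the degree function `δ` are those of `A`. -/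
structure T0 (δ : DegreeFunction A K) where
  of : A

/-- Morphisms of `T⁰` are formal linear combinations of relations; they are composed by
`compHom`, and the identities are the diagonals. -/
noncomputable instance : Category (T0 δ) where
  Hom X Y := Rel X.of Y.of →₀ K
  id X := Finsupp.single (graph (𝟙 X.of)).toRel 1
  comp {X Y Z} φ ψ := compHom δ X.of Y.of Z.of φ ψ
  id_comp φ := id_compHom δ φ
  comp_id φ := compHom_id δ φ
  assoc φ ψ χ := compHom_assoc δ φ ψ χ

noncomputable instance : Preadditive (T0 δ) where
  homGroup X Y := inferInstanceAs (AddCommGroup (Rel X.of Y.of →₀ K))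
  add_comp X Y Z := @compHom_add_left A _ K _ _ δ X.of Y.of Z.of
  comp_add X Y Z := @compHom_add_right A _ K _ _ δ X.of Y.of Z.of

noncomputable instance : Linear K (T0 δ) where
  homModule X Y := inferInstanceAs (Module K (Rel X.of Y.of →₀ K))
  smul_comp X Y Z := @compHom_smul_left A _ K _ _ δ X.of Y.of Z.of
  comp_smul X Y Z := @compHom_smul_right A _ K _ _ δ X.of Y.of Z.of

/-- The object `[x]` of `T⁰`. -/
abbrev T0.obj (x : A) : T0 δ := ⟨x⟩

/-- The morphism `⟨r⟩ : [x] ⟶ [y]` of a relation `r`. -/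
noncomputable def T0.rel {x y : A} (r : Rel x y) : T0.obj δ x ⟶ T0.obj δ y :=
  Finsupp.single r (1 : K)

/-- The morphism `[f] : [x] ⟶ [y]`. -/
noncomputable def T0.map {x y : A} (f : x ⟶ y) : T0.obj δ x ⟶ T0.obj δ y :=
  T0.rel δ (graph f).toRel

/-- The morphism `[f]^∨ : [y] ⟶ [x]`. -/
noncomputable def T0.mapAdj {x y : A} (f : x ⟶ y) : T0.obj δ y ⟶ T0.obj δ x :=
  T0.rel δ (graphAdj f).toRel

end T0

/-! ### Möbius functions and the idempotents `p_x^*` -/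

open Classical in
/-- The Möbius function of a finite partially ordered set. -/
noncomputable def mobius {α : Type*} [PartialOrder α] [Finite α] (a b : α) : ℤ :=
  letI : Fintype α := Fintype.ofFinite α
  letI : LocallyFiniteOrder α := Fintype.toLocallyFiniteOrder
  IncidenceAlgebra.mu ℤ a b

section Mobius

variable {α : Type*} [PartialOrder α] [Fintype α]

lemma mobius_self (a : α) : mobius a a = 1 := by
  classical
  let _ : LocallyFiniteOrder α := @Fintype.toLocallyFiniteOrder α _ (Fintype.ofFinite α) _ _
  exact IncidenceAlgebra.mu_self (𝕜 := ℤ) a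

open Classical in
lemma sum_mobius_left (a b : α) :
    ∑ u : α, (if a ≤ u ∧ u ≤ b then mobius u b else 0) = if a = b then 1 else 0 := by
  let _ : LocallyFiniteOrder α := @Fintype.toLocallyFiniteOrder α _ (Fintype.ofFinite α) _ _
  rw [← IncidenceAlgebra.sum_Icc_mu_left (𝕜 := ℤ) a b, ← Finset.sum_filter]
  refine Finset.sum_congr (by ext; simp) fun u _ => rfl

open Classical in
/-- Weisner's theorem, for a partial order in which only the pairs with a common lower bound are
required to have a meet. -/
lemma sum_mobius_meet [OrderTop α]
    (hm : ∀ a b c : α, c ≤ a → c ≤ b → ∃ m, IsGLB {a, b} m) (v : α) (hv : v ≠ ⊤) (w : α) :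
    ∑ u : α, (if IsGLB {u, v} w then mobius u ⊤ else 0) = 0 := by
  induction w using WellFoundedGT.induction with
  | ind w ih =>
    by_cases hw : w ≤ v
    · have h1 : ∑ w' : α, (if w ≤ w' then
          ∑ u : α, (if IsGLB {u, v} w' then mobius u ⊤ else 0) else 0) = 0 := by
        have hne : w ≠ ⊤ := fun h => hv (top_le_iff.1 (h ▸ hw))
        have h2 := sum_mobius_left w (⊤ : α)
        rw [if_neg hne] at h2
        refine Eq.trans ?_ h2
        have : ∀ w' : α, (if w ≤ w' then
            ∑ u : α, (if IsGLB {u, v} w' then mobius u ⊤ else 0) else 0) =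
            ∑ u : α, if w ≤ w' ∧ IsGLB {u, v} w' then mobius u ⊤ else 0 := by
          intro w'
          by_cases h : w ≤ w'
          · rw [if_pos h]
            exact Finset.sum_congr rfl fun u _ => by simp only [h, true_and]
          · rw [if_neg h]
            exact (Finset.sum_eq_zero fun u _ => if_neg fun h' => h h'.1).symm
        rw [Finset.sum_congr rfl fun w' _ => this w', Finset.sum_comm]
        refine Finset.sum_congr rfl fun u _ => ?_
        by_cases hu : w ≤ u
        · obtain ⟨m, hmm⟩ := hm u v w hu hw
          have hwm : w ≤ m := hmm.2 (by rintro _ (rfl | rfl) <;> assumption)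
          rw [if_pos ⟨hu, le_top⟩, Finset.sum_eq_single m]
          · rw [if_pos ⟨hwm, hmm⟩]
          · intro w' _ hne'
            rw [if_neg fun h => hne' (h.2.unique hmm)]
          · simp
        · rw [if_neg fun h => hu h.1]
          refine Finset.sum_eq_zero fun w' _ => if_neg fun h => hu (h.1.trans (h.2.1 (by simp)))
      rw [Finset.sum_eq_single w] at h1
      · simpa using h1
      · intro w' _ hne
        by_cases h : w ≤ w'
        · rw [if_pos h]; exact ih w' (lt_of_le_of_ne h hne.symm)
        · rw [if_neg h]
      · simp
    · refine Finset.sum_eq_zero fun u _ => if_neg fun h => hw (h.1 (by simp))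

end Mobius

section Star

variable {A : Type u} [Category.{v} A] [RegularCat A] {K : Type w} [CommRing K]
  (δ : DegreeFunction A K)

/-- The idempotent `p_u = [i] [i]^∨` of the subobject `i : u ⟶ x`. -/
noncomputable def proj {x : A} (u : Subobject x) : T0.obj δ x ⟶ T0.obj δ x :=
  T0.mapAdj δ u.arrow ≫ T0.map δ u.arrow

lemma proj_eq_spanHom {x : A} (u : Subobject x) : proj δ u = spanHom δ u.arrow u.arrow := by
  have h1 : T0.mapAdj δ u.arrow = spanHom δ u.arrow (𝟙 _) :=
    (spanHom_mono δ (graphAdj u.arrow)).symm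
  have h2 : T0.map δ u.arrow = spanHom δ (𝟙 _) u.arrow :=
    (spanHom_mono δ (graph u.arrow)).symm
  rw [proj, h1, h2]
  exact (compHom_spanHom δ _ _ _ _ (IsPullback.id_horiz (𝟙 _))).trans (by simp)

lemma proj_top {x : A} : proj δ (⊤ : Subobject x) = 𝟙 _ := by
  rw [proj_eq_spanHom]
  have := spanHom_precomp δ (⊤ : Subobject x).arrow (Surj.of_isIso _) (𝟙 x) (𝟙 x)
  rw [Category.comp_id, δ.deg_iso, one_smul] at this
  rw [this]
  exact spanHom_mono δ (graph (𝟙 x))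

lemma spanHom_eq_proj {x y : A} (f : y ⟶ x) [Mono f] :
    spanHom δ f f = proj δ (Subobject.mk f) := by
  rw [proj_eq_spanHom]
  have := spanHom_precomp δ (Subobject.underlyingIso f).inv (Surj.of_isIso _)
    (Subobject.mk f).arrow (Subobject.mk f).arrow
  rwa [δ.deg_iso, one_smul, Subobject.underlyingIso_arrow] at this

lemma hasPullback_of_le {x : A} {u v c : Subobject x} (hu : c ≤ u) (hv : c ≤ v) :
    HasPullback u.arrow v.arrow :=
  RegularCat.hasPullback (Subobject.ofLE c u hu) (Subobject.ofLE c v hv) _ _ (by simp)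

lemma exists_meet {x : A} (u v : Subobject x) (h : HasPullback u.arrow v.arrow) :
    ∃ m : Subobject x, IsGLB {u, v} m ∧ proj δ u ≫ proj δ v = proj δ m := by
  have hp := IsPullback.of_hasPullback u.arrow v.arrow
  have : Mono (pullback.fst u.arrow v.arrow) := hp.mono_fst_of_mono
  refine ⟨Subobject.mk (pullback.fst u.arrow v.arrow ≫ u.arrow), ⟨?_, ?_⟩, ?_⟩
  · rintro _ (rfl | rfl)
    · exact Subobject.mk_le_of_comm (pullback.fst _ _) rfl
    · exact Subobject.mk_le_of_comm (pullback.snd _ _) pullback.condition.symm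
  · intro c hc
    have hu : c ≤ u := hc (by simp)
    have hv : c ≤ v := hc (by simp)
    refine Subobject.le_mk_of_comm
      (hp.lift (Subobject.ofLE c u hu) (Subobject.ofLE c v hv) (by simp)) ?_
    rw [← Category.assoc, hp.lift_fst, Subobject.ofLE_arrow]
  · rw [← spanHom_eq_proj, proj_eq_spanHom, proj_eq_spanHom]
    refine (compHom_spanHom δ _ _ _ _ hp).trans ?_
    rw [hp.w]

lemma proj_comp_zero {x : A} (u v : Subobject x) (h : ¬ HasPullback u.arrow v.arrow) :
    proj δ u ≫ proj δ v = 0 := by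
  rw [proj_eq_spanHom, proj_eq_spanHom]
  exact compHom_spanHom_zero δ _ _ _ _ h

lemma map_comp_mapAdj {r x y u : A} {p : r ⟶ x} {q : r ⟶ y} {a : x ⟶ u} {b : y ⟶ u}
    (h : IsPullback p q a b) : T0.map δ a ≫ T0.mapAdj δ b = spanHom δ p q := by
  have h1 : T0.map δ a = spanHom δ (𝟙 _) a := (spanHom_mono δ (graph a)).symm
  have h2 : T0.mapAdj δ b = spanHom δ b (𝟙 _) := (spanHom_mono δ (graphAdj b)).symm
  rw [h1, h2]
  exact (compHom_spanHom δ _ _ _ _ h).trans (by simp)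

variable [SubobjectFinite A]

/-- The idempotent `p_x^* = ∑_{u ⊆ x} μ(u, x) p_u`. -/
noncomputable def pStar (x : A) : T0.obj δ x ⟶ T0.obj δ x :=
  ∑ᶠ u : Subobject x, mobius u ⊤ • proj δ u

lemma pStar_comp_proj {x : A} (v : Subobject x) (hv : v ≠ ⊤) : pStar δ x ≫ proj δ v = 0 := by
  classical
  have : Fintype (Subobject x) := Fintype.ofFinite _
  have key : ∀ u : Subobject x, proj δ u ≫ proj δ v =
      ∑ w : Subobject x, if IsGLB {u, v} w then proj δ w else 0 := by
    intro u
    by_cases h : HasPullback u.arrow v.arrow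
    · obtain ⟨m, hm, hp⟩ := exists_meet δ u v h
      rw [hp, Finset.sum_eq_single m]
      · rw [if_pos hm]
      · intro w _ hw
        exact if_neg fun h => hw (h.unique hm)
      · simp
    · rw [proj_comp_zero δ u v h]
      refine (Finset.sum_eq_zero fun w _ => if_neg fun hw => h ?_).symm
      exact hasPullback_of_le (hw.1 (by simp)) (hw.1 (by simp))
  have hmeet : ∀ a b c : Subobject x, c ≤ a → c ≤ b → ∃ m, IsGLB {a, b} m := by
    intro a b c ha hb
    obtain ⟨m, hm, -⟩ := exists_meet δ a b (hasPullback_of_le ha hb)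
    exact ⟨m, hm⟩
  rw [pStar, finsum_eq_sum_of_fintype, Preadditive.sum_comp]
  simp_rw [Preadditive.zsmul_comp, key, Finset.smul_sum]
  rw [Finset.sum_comm]
  refine Finset.sum_eq_zero fun w _ => ?_
  have := sum_mobius_meet hmeet v hv w
  have h0 := congrArg (fun n : ℤ => n • proj δ w) this
  simp only [zero_smul, Finset.sum_smul] at h0
  refine Eq.trans (Finset.sum_congr rfl fun u _ => ?_) h0
  by_cases h : IsGLB {u, v} w <;> simp [h]

lemma pStar_idem (x : A) : pStar δ x ≫ pStar δ x = pStar δ x := by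
  classical
  have : Fintype (Subobject x) := Fintype.ofFinite _
  have h : pStar δ x = ∑ u : Subobject x, mobius u ⊤ • proj δ u := finsum_eq_sum_of_fintype _
  conv_lhs => arg 2; rw [h]
  rw [Preadditive.comp_sum, Finset.sum_eq_single ⊤]
  · rw [Preadditive.comp_zsmul, mobius_self, one_smul, proj_top, Category.comp_id]
  · intro v _ hv
    rw [Preadditive.comp_zsmul, pStar_comp_proj δ v hv, smul_zero]
  · simp

end Star

/-! ### The pseudo-abelian category `T` -/

section Karoubi

open Idempotents

variable {K : Type w} [CommRing K] {C : Type*} [Category C] [Preadditive C] [Linear K C]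

instance (P Q : Karoubi C) : SMul K (P ⟶ Q) where
  smul k f := ⟨k • f.f, by
    rw [Linear.smul_comp, Linear.comp_smul, f.comm]⟩

@[simp] lemma karoubi_smul_f {P Q : Karoubi C} (k : K) (f : P ⟶ Q) : (k • f).f = k • f.f := rfl

instance (P Q : Karoubi C) : Module K (P ⟶ Q) where
  one_smul f := by ext; simp
  mul_smul a b f := by ext; simp [mul_smul]
  smul_zero a := by ext; simp
  smul_add a f g := by ext; simp
  add_smul a b f := by ext; simp [add_smul]
  zero_smul f := by ext; simp

end Karoubi

/-! ### Co-relations -/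

section Corel

variable {A : Type u} [Category.{v} A]

variable (A) in
/-- Representatives of co-relations: diagrams `x ↠ u ↞ y`. -/
structure Cospan (x y : A) where
  obj : A
  left : x ⟶ obj
  right : y ⟶ obj
  surj_left : Surj left
  surj_right : Surj right

/-- `u ≤ v` if the pair `x ↠ v ↞ y` factors through the pair `x ↠ u ↞ y`. -/
instance (x y : A) : Preorder (Cospan A x y) where
  le u v := ∃ h : u.obj ⟶ v.obj, u.left ≫ h = v.left ∧ u.right ≫ h = v.right
  le_refl u := ⟨𝟙 _, by simp, by simp⟩
  le_trans u v w := by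
    rintro ⟨h, h1, h2⟩ ⟨k, k1, k2⟩
    exact ⟨h ≫ k, by rw [← Category.assoc, h1, k1], by rw [← Category.assoc, h2, k2]⟩

/-- The partially ordered set of co-relations between `x` and `y`, i.e. of isomorphism classes of
diagrams `x ↠ u ↞ y` (see `Cospan.toCorel_eq_iff`). -/
abbrev Corel (x y : A) : Type max u v := Antisymmetrization (Cospan A x y) (· ≤ ·)

/-- The co-relation represented by a diagram `x ↠ u ↞ y`. -/
abbrev Cospan.toCorel {x y : A} (u : Cospan A x y) : Corel x y := toAntisymmetrization (· ≤ ·) u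

/-- A chosen representative of a co-relation. -/
noncomputable abbrev Corel.rep {x y : A} (u : Corel x y) : Cospan A x y :=
  ofAntisymmetrization (· ≤ ·) u

variable [RegularCat A]

lemma Cospan.toCorel_eq_iff {x y : A} (u v : Cospan A x y) :
    u.toCorel = v.toCorel ↔
      ∃ i : u.obj ≅ v.obj, u.left ≫ i.hom = v.left ∧ u.right ≫ i.hom = v.right := by
  constructor
  · intro h
    obtain ⟨⟨h, h1, h2⟩, ⟨k, k1, k2⟩⟩ := Quotient.exact h
    have := u.surj_left.epi
    have := v.surj_left.epi
    refine ⟨⟨h, k, ?_, ?_⟩, h1, h2⟩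
    · rw [← cancel_epi u.left, ← Category.assoc, h1, k1, Category.comp_id]
    · rw [← cancel_epi v.left, ← Category.assoc, k1, h1, Category.comp_id]
  · rintro ⟨i, h1, h2⟩
    exact Quotient.sound ⟨⟨i.hom, h1, h2⟩, ⟨i.inv, by simp [← h1], by simp [← h2]⟩⟩

/-- A diagram `u ↠ t ↞ v` regarded as a diagram `x ↠ t ↞ z` via surjections `x ↠ u` and
`z ↠ v`. -/
def Cospan.extend {x z u v : A} (t : Cospan A u v) (a : x ⟶ u) (d : z ⟶ v) (ha : Surj a)
    (hd : Surj d) : Cospan A x z where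
  obj := t.obj
  left := a ≫ t.left
  right := d ≫ t.right
  surj_left := ha.comp t.surj_left
  surj_right := hd.comp t.surj_right

/-- A surjective morphism is the quotient by its kernel pair. -/
lemma Surj.exists_desc {x y z : A} {a : x ⟶ y} (ha : Surj a) (g : x ⟶ z)
    (h : ∀ ⦃t : A⦄ (p q : t ⟶ x), p ≫ a = q ≫ a → p ≫ g = q ≫ g) : ∃ k : y ⟶ z, a ≫ k = g := by
  obtain ⟨r, e, he, h1, h2⟩ := exists_spanImage a g
  have : Mono r.fst := by
    refine ⟨fun {t} s s' hs => r.jm _ _ hs ?_⟩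
    obtain ⟨t₁, p₁, q₁, hp₁, hq₁⟩ := RegularCat.surj_pullback e s he
    obtain ⟨t₂, p₂, q₂, hp₂, hq₂⟩ := RegularCat.surj_pullback e (q₁ ≫ s') he
    have := (hq₂.comp hq₁).epi
    have w1 : p₁ ≫ e = q₁ ≫ s := hp₁.w
    have w2 : p₂ ≫ e = q₂ ≫ q₁ ≫ s' := hp₂.w
    have e1 : (q₂ ≫ p₁) ≫ e = (q₂ ≫ q₁) ≫ s := by simp [w1]
    have e2 : p₂ ≫ e = (q₂ ≫ q₁) ≫ s' := by simp [w2]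
    have key := h (q₂ ≫ p₁) p₂ (by
      rw [← h1, ← Category.assoc, ← Category.assoc, e1, e2, Category.assoc, hs, ← Category.assoc])
    rw [← h2, ← Category.assoc, ← Category.assoc, e1, e2, Category.assoc, Category.assoc _ s'] at key
    exact (cancel_epi _).1 key
  have : IsIso r.fst := ha e r.fst h1
  exact ⟨inv r.fst ≫ r.snd, by rw [← h2, ← h1]; simp⟩

/-- The fibre product of `x` and `y` over `u`, as a relation. -/
lemma Cospan.exists_fiberProduct {x y : A} (u : Cospan A x y) :
    ∃ r : MonoSpan A x y, IsPullback r.fst r.snd u.left u.right := by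
  obtain ⟨r, p, q, h, -⟩ := RegularCat.surj_pullback u.left u.right u.surj_left
  exact ⟨⟨r, p, q, fun t f g h1 h2 => h.hom_ext h1 h2⟩, h⟩

lemma Cospan.le_of_fiberProduct_le {x y : A} {u v : Cospan A x y} {r s : MonoSpan A x y}
    (hr : IsPullback r.fst r.snd u.left u.right) (hs : IsPullback s.fst s.snd v.left v.right)
    (h : r ≤ s) : u ≤ v := by
  obtain ⟨l, l1, l2⟩ := h
  have hrel : ∀ {t : A} (p : t ⟶ x) (q : t ⟶ y), p ≫ u.left = q ≫ u.right →
      p ≫ v.left = q ≫ v.right := by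
    intro t p q hpq
    have h1 : hr.lift p q hpq ≫ r.fst = p := hr.lift_fst _ _ _
    have h2 : hr.lift p q hpq ≫ r.snd = q := hr.lift_snd _ _ _
    calc p ≫ v.left = hr.lift p q hpq ≫ l ≫ s.fst ≫ v.left := by
          rw [← Category.assoc l, l1, ← Category.assoc, h1]
      _ = q ≫ v.right := by rw [hs.w, ← Category.assoc l, l2, ← Category.assoc, h2]
  obtain ⟨k, hk⟩ := u.surj_left.exists_desc v.left (by
    intro t p q hpq
    obtain ⟨t', b, c, hb, hc⟩ := RegularCat.surj_pullback u.right (p ≫ u.left) u.surj_right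
    have := hc.epi
    have w : b ≫ u.right = c ≫ p ≫ u.left := hb.w
    have e1 := hrel (c ≫ p) b (by rw [w, Category.assoc])
    have e2 := hrel (c ≫ q) b (by rw [w, Category.assoc, hpq])
    rw [← cancel_epi c, ← Category.assoc, ← Category.assoc, e1, e2])
  refine ⟨k, hk, ?_⟩
  have := (Surj.of_isPullback hr u.surj_left).epi
  rw [← cancel_epi r.snd, ← Category.assoc, ← hr.w, Category.assoc, hk]
  exact hrel _ _ hr.w

instance [SubobjectFinite A] (x y : A) : Finite (Rel x y) := by
  rcases isEmpty_or_nonempty (Rel x y) with h | h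
  · infer_instance
  obtain ⟨r₁⟩ : Nonempty (MonoSpan A x y) := h.map Rel.rep
  have := hasBinaryProduct_of_cone r₁.fst r₁.snd
  have hm : ∀ r : MonoSpan A x y, Mono (prod.lift r.fst r.snd) := fun r =>
    ⟨fun f g h => r.jm f g (by simpa [prod.lift_fst] using h =≫ prod.fst)
      (by simpa [prod.lift_snd] using h =≫ prod.snd)⟩
  have hle : ∀ r s : MonoSpan A x y,
      Subobject.mk (prod.lift r.fst r.snd) ≤ Subobject.mk (prod.lift s.fst s.snd) → r ≤ s := by
    intro r s h
    have := Subobject.ofMkLEMk_comp h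
    exact ⟨Subobject.ofMkLEMk _ _ h, by simpa [prod.lift_fst] using this =≫ prod.fst,
      by simpa [prod.lift_snd] using this =≫ prod.snd⟩
  refine Finite.of_injective
    (fun r : Rel x y => Subobject.mk (prod.lift r.rep.fst r.rep.snd)) fun r s h => ?_
  rw [← toAntisymmetrization_ofAntisymmetrization (· ≤ ·) r,
    ← toAntisymmetrization_ofAntisymmetrization (· ≤ ·) s]
  exact Quotient.sound ⟨hle _ _ (le_of_eq h), hle _ _ (le_of_eq h.symm)⟩

instance [SubobjectFinite A] (x y : A) : Finite (Corel x y) := by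
  choose F hF using fun u : Cospan A x y => u.exists_fiberProduct
  refine Finite.of_injective (fun u : Corel x y => (F u.rep).toRel) fun u v h => ?_
  obtain ⟨h1, h2⟩ := Quotient.exact h
  rw [← toAntisymmetrization_ofAntisymmetrization (· ≤ ·) u,
    ← toAntisymmetrization_ofAntisymmetrization (· ≤ ·) v]
  exact Quotient.sound ⟨Cospan.le_of_fiberProduct_le (hF _) (hF _) h1,
    Cospan.le_of_fiberProduct_le (hF _) (hF _) h2⟩

end Corel

/-! ### The objects `[x]^*` and the morphisms `{u}'` -/

section Main

variable {A : Type u} [Category.{v} A] [RegularCat A] [SubobjectFinite A] {K : Type w} [CommRing K]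
  (δ : DegreeFunction A K)

/-- The direct summand `[x]^* = p_x^* [x]` of `[x]`, an object of the category of direct summands
of objects of `T⁰`. This is a full subcategory of the pseudo-abelian closure of `T⁰`; finite direct
sums are not needed. -/
noncomputable def starObj (x : A) : Idempotents.Karoubi (T0 δ) where
  X := T0.obj δ x
  p := pStar δ x
  idem := pStar_idem δ x

/-- The morphism `{u}' = p_y^* [b]^∨ [a] p_x^*` for a diagram `x ↠ u ↞ y` with legs `a` and `b`, as
a morphism `[x] ⟶ [y]` of `T⁰`. -/
noncomputable def corelHomT0 {x y : A} (u : Cospan A x y) : T0.obj δ x ⟶ T0.obj δ y :=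
  pStar δ x ≫ T0.map δ u.left ≫ T0.mapAdj δ u.right ≫ pStar δ y

lemma pStar_corelHomT0_pStar {x y : A} (u : Cospan A x y) :
    pStar δ x ≫ corelHomT0 δ u ≫ pStar δ y = corelHomT0 δ u := by
  simp only [corelHomT0, Category.assoc, pStar_idem]
  rw [← Category.assoc, pStar_idem]

/-- The morphism `{u}' : [x]^* ⟶ [y]^*` for a diagram `x ↠ u ↞ y`. -/
noncomputable def corelHom {x y : A} (u : Cospan A x y) : starObj δ x ⟶ starObj δ y where
  f := corelHomT0 δ u
  comm := pStar_corelHomT0_pStar δ u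

/-- The morphism `{u}'` depends only on the co-relation represented by `x ↠ u ↞ y`. -/
lemma corelHom_congr {x y : A} {u v : Cospan A x y} (h : u.toCorel = v.toCorel) :
    corelHom δ u = corelHom δ v := by
  obtain ⟨i, h1, h2⟩ := (Cospan.toCorel_eq_iff u v).1 h
  obtain ⟨r, hr⟩ := u.exists_fiberProduct
  have hr' : IsPullback r.fst r.snd v.left v.right :=
    hr.of_iso (Iso.refl _) (Iso.refl _) (Iso.refl _) i (by simp) (by simp) (by simp [h1])
      (by simp [h2])
  have := (map_comp_mapAdj δ hr).trans (map_comp_mapAdj δ hr').symm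
  refine Idempotents.Karoubi.hom_ext _ _ ?_
  change corelHomT0 δ u = corelHomT0 δ v
  rw [corelHomT0, corelHomT0, ← Category.assoc (T0.map δ u.left), this, Category.assoc]

open Classical in
/-- The invariant `ω_e = ∑_{e(u) = y} μ(u, x) δ(u ↠ y)` of a surjective morphism `e : x ⟶ y`, where
`u` runs through the subobjects of `x` that are mapped onto `y`. -/
noncomputable def omega {x y : A} (e : x ⟶ y) : K :=
  ∑ᶠ u : Subobject x, if h : Surj (u.arrow ≫ e) then mobius u ⊤ • δ.deg (u.arrow ≫ e) h else 0

end Main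

end TensorEnvelope

/-! Write `a : x ⟶ u`, `b : y ⟶ u`, `c : y ⟶ v`, `d : z ⟶ v` for the legs. Since `p_y^*` is
idempotent, `{v}'{u}' = p_z^* [d]^∨ ([c] p_y^* [b]^∨) [a] p_x^*`. The pair `(b, c)` factors through
the surjection `e : y ⟶ ȳ` onto its image, so the bracket contains `[e] p_y^* [e]^∨`, which equals
`ω_e p_ȳ^*` (`mapAdj_pStar_map`). This produces the scalar. Expanding `p_ȳ^*` leaves a Möbius sum
over the subobjects `s` of `ȳ`, each regarded as a relation between `u` and `v`.

The outer idempotents kill every `s` that fails to project onto `u` or onto `v`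
(`pStar_comp_map_comp_span`, `span_comp_mapAdj_comp_pStar`). The remaining ones are governed by the
Mal'tsev and exactness axioms: a relation with surjective projections is the fibre product over its
own pushout (`MonoSpan.exists_pushout`). Applied to `ȳ` this gives `w`; applied to `s` it gives a
co-relation `t ≤ w`, and the term of `s` becomes a multiple of `{t}'`.

The coefficients agree because the surviving `s` form an upwards closed part of the poset of
subobjects of `ȳ`, isomorphic to the co-relations below `w` (`exists_subobject_embedding`), and a
Möbius value `μ(s, ⊤)` depends only on the interval above `s` (`mobius_map`). -/

namespace TensorEnvelope

/-! ### Difunctional relations and their pushouts -/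

section Quotients

variable {A : Type u} [Category.{v} A] [RegularCat A]

/-- Relations in a Mal'tsev category are difunctional. -/
lemma MonoSpan.difunctional [Maltsev A] {x y : A} (r : MonoSpan A x y) (hp : Surj r.fst)
    (hq : Surj r.snd) {t : A} (a b c : t ⟶ r.obj) (h1 : a ≫ r.snd = b ≫ r.snd)
    (h2 : b ≫ r.fst = c ≫ r.fst) :
    ∃ d : t ⟶ r.obj, d ≫ r.fst = a ≫ r.fst ∧ d ≫ r.snd = c ≫ r.snd := by
  -- On generalized elements, `s` below is the relation on `r.obj` that holds for `(f, g)` when the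
  -- pair formed by the first coordinate of `f` and the second coordinate of `g` again lies in `r`;
  -- the witness `k` is that pair.
  obtain ⟨m, m₁, m₃, hm, -⟩ := RegularCat.surj_pullback r.fst r.fst hp
  obtain ⟨n, n₂, n₃, hn, hn₃⟩ := RegularCat.surj_pullback r.snd r.snd hq
  obtain ⟨s, i, j, hs, -⟩ := RegularCat.surj_pullback n₃ m₃ hn₃
  have lift : ∀ {t : A} (f g k : t ⟶ r.obj), f ≫ r.fst = k ≫ r.fst → g ≫ r.snd = k ≫ r.snd →
      ∃ l : t ⟶ s, l ≫ j ≫ m₁ = f ∧ l ≫ i ≫ n₂ = g := by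
    intro t f g k hf hg
    refine ⟨hs.lift (hn.lift g k hg) (hm.lift f k hf) (by simp), ?_, ?_⟩
    · rw [hs.lift_snd_assoc, hm.lift_fst]
    · rw [hs.lift_fst_assoc, hn.lift_fst]
  have hjm : JointlyMono (j ≫ m₁) (i ≫ n₂) := by
    intro t f g e1 e2
    simp only [← Category.assoc] at e1 e2
    -- The witness is determined by its two coordinates, so `s` embeds in the square of `r.obj`.
    have e3 : f ≫ j ≫ m₃ = g ≫ j ≫ m₃ := by
      refine r.jm _ _ ?_ ?_
      · rw [Category.assoc, Category.assoc, ← hm.w, Category.assoc, Category.assoc, ← hm.w]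
        simp only [← Category.assoc, e1]
      · rw [← hs.w, Category.assoc, Category.assoc, ← hn.w, Category.assoc, Category.assoc, ← hn.w]
        simp only [← Category.assoc, e2]
    refine hs.hom_ext (hn.hom_ext e2 ?_) (hm.hom_ext e1 ?_)
    · simpa [hs.w] using e3
    · simpa using e3
  obtain ⟨-, he⟩ := Maltsev.isEquivRel (A := A) ⟨s, j ≫ m₁, i ≫ n₂, hjm⟩ (by
    obtain ⟨l, l1, l2⟩ := lift (𝟙 r.obj) (𝟙 _) (𝟙 _) rfl rfl
    exact ⟨l, l1, l2⟩)
  -- The element `b` witnesses that `c` is related to `a`. Symmetry relates `a` to `c`, and the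
  -- witness of that is the desired `d`.
  obtain ⟨l, l1, l2⟩ := (he t).symm (lift c a b h2.symm h1)
  refine ⟨l ≫ j ≫ m₃, ?_, ?_⟩
  · rw [← l1, Category.assoc, Category.assoc, ← hm.w]
    simp
  · change l ≫ i ≫ n₂ = c at l2
    rw [← l2, ← hs.w, Category.assoc, Category.assoc, ← hn.w]
    simp

/-- In an exact Mal'tsev category, a relation with surjective projections has a pushout, and is
the fibre product over it. -/
lemma MonoSpan.exists_pushout [ExactCat A] [Maltsev A] {x y : A} (r : MonoSpan A x y)
    (hp : Surj r.fst) (hq : Surj r.snd) :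
    ∃ w : Cospan A x y, IsPullback r.fst r.snd w.left w.right ∧
      IsPushout r.fst r.snd w.left w.right := by
  obtain ⟨n, n₁, n₂, hn, -⟩ := RegularCat.surj_pullback r.snd r.snd hq
  -- The relation `s` identifies two elements of `x` that share a partner in `y` under `r`. It is
  -- reflexive because every element of `x` has a partner locally, `r.fst` being surjective.
  obtain ⟨s, c, hc, c1, c2⟩ := exists_spanImage (n₁ ≫ r.fst) (n₂ ≫ r.fst)
  have hs := Maltsev.isEquivRel s (by
    refine hp.lift_jm s.jm (hn.lift (𝟙 _) (𝟙 _) rfl ≫ c) ?_ ?_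
    · rw [Category.assoc, c1, hn.lift_fst_assoc]; simp
    · rw [Category.assoc, c2, hn.lift_snd_assoc]; simp)
  obtain ⟨t, e, he, hk⟩ := ExactCat.exists_quotient _ _ hs
  -- As `s` is only an image, a common partner of two identified elements exists after passing to a
  -- surjective cover.
  have cover : ∀ {z : A} (a b : z ⟶ x), a ≫ e = b ≫ e → ∃ (z' : A) (π : z' ⟶ z) (f g : z' ⟶ r.obj),
      Surj π ∧ f ≫ r.fst = π ≫ a ∧ g ≫ r.fst = π ≫ b ∧ f ≫ r.snd = g ≫ r.snd := by
    intro z a b hab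
    obtain ⟨z', l, π, h, hπ⟩ := RegularCat.surj_pullback c (hk.lift a b hab) hc
    refine ⟨z', π, l ≫ n₁, l ≫ n₂, hπ, ?_, ?_, ?_⟩
    · rw [Category.assoc, ← c1, ← Category.assoc, h.w, Category.assoc, hk.lift_fst]
    · rw [Category.assoc, ← c2, ← Category.assoc, h.w, Category.assoc, hk.lift_snd]
    · rw [Category.assoc, Category.assoc, hn.w]
  obtain ⟨k, hqk⟩ := hq.exists_desc (r.fst ≫ e) (by
    intro z a b hab
    have h1 : hn.lift a b hab ≫ c ≫ s.fst = a ≫ r.fst := by rw [c1, hn.lift_fst_assoc]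
    have h2 : hn.lift a b hab ≫ c ≫ s.snd = b ≫ r.fst := by rw [c2, hn.lift_snd_assoc]
    rw [← Category.assoc, ← h1, ← Category.assoc b, ← h2]
    simp [hk.w])
  have hks : Surj k := Surj.of_comp (f := r.snd) (hqk ▸ hp.comp he)
  -- Locally `b` has a partner in `x`, which is identified with `a` and hence shares a partner in
  -- `y` with it. Difunctionality then puts `(a, b)` in `r`; joint injectivity of `r` descends this
  -- from the cover.
  have hl : ∀ {z : A} (a : z ⟶ x) (b : z ⟶ y), a ≫ e = b ≫ k →
      ∃ l : z ⟶ r.obj, l ≫ r.fst = a ∧ l ≫ r.snd = b := by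
    intro z a b hab
    obtain ⟨z₁, l, π, h, hπ⟩ := RegularCat.surj_pullback r.snd b hq
    obtain ⟨z₂, ρ, f, g, hρ, hf, hg, hfg⟩ := cover (π ≫ a) (l ≫ r.fst) (by
      rw [Category.assoc, hab, Category.assoc, ← hqk, ← Category.assoc l, h.w, Category.assoc])
    obtain ⟨d, d1, d2⟩ := r.difunctional hp hq f g (ρ ≫ l) hfg (by rw [hg, Category.assoc])
    refine (hρ.comp hπ).lift_jm r.jm d ?_ ?_
    · rw [d1, hf, Category.assoc]
    · rw [d2, Category.assoc, h.w, Category.assoc]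
  have hd : ∀ {z : A} (f : x ⟶ z) (g : y ⟶ z), r.fst ≫ f = r.snd ≫ g →
      ∃ h : t ⟶ z, e ≫ h = f ∧ k ≫ h = g := by
    intro z f g hfg
    -- Elements identified by `e` locally share a partner in `y`, and `f` is computed by applying
    -- `g` to that partner.
    obtain ⟨h, hh⟩ := he.exists_desc f (by
      intro T a b hab
      obtain ⟨z', π, c, d, hπ, hc, hd, hcd⟩ := cover a b hab
      have := hπ.epi
      rw [← cancel_epi π, ← Category.assoc, ← Category.assoc, ← hc, ← hd, Category.assoc,
        Category.assoc, hfg, ← Category.assoc, ← Category.assoc, hcd])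
    refine ⟨h, hh, ?_⟩
    have := hq.epi
    rw [← cancel_epi r.snd, ← Category.assoc, hqk, Category.assoc, hh, hfg]
  choose l l1 l2 using fun s : PullbackCone e k => hl s.fst s.snd s.condition
  choose d d1 d2 using fun s : PushoutCocone r.fst r.snd => hd s.inl s.inr s.condition
  have := he.epi
  exact ⟨⟨t, e, k, he, hks⟩,
    ⟨⟨hqk.symm⟩, ⟨PullbackCone.IsLimit.mk _ l l1 l2 fun s m m1 m2 =>
      r.jm _ _ (m1.trans (l1 s).symm) (m2.trans (l2 s).symm)⟩⟩,
    ⟨⟨hqk.symm⟩, ⟨PushoutCocone.IsColimit.mk _ d d1 d2 fun s m m1 _ =>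
      (cancel_epi e).1 (m1.trans (d1 s).symm)⟩⟩⟩

end Quotients

/-! ### Transport of Möbius functions between posets -/

section PosetMobius

variable {α β : Type*} [PartialOrder α] [Fintype α] [PartialOrder β] [Fintype β]

-- The recursion expresses the value at `a` through the values at strictly larger elements below
-- `b`, so downward induction shows that it has a single solution.
open Classical in
lemma eq_mobius_of_sum {b : α} (g : α → ℤ)
    (hg : ∀ a ≤ b, ∑ u : α, (if a ≤ u ∧ u ≤ b then g u else 0) = if a = b then 1 else 0)
    (a : α) (ha : a ≤ b) : g a = mobius a b := by
  induction a using WellFoundedGT.induction with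
  | ind a ih =>
    have h := (hg a ha).trans (sum_mobius_left a b).symm
    rw [← Finset.add_sum_erase _ _ (Finset.mem_univ a),
      ← Finset.add_sum_erase _ _ (Finset.mem_univ a), if_pos ⟨le_rfl, ha⟩, if_pos ⟨le_rfl, ha⟩,
      Finset.sum_congr rfl (g := fun u => if a ≤ u ∧ u ≤ b then mobius u b else 0)] at h
    · exact add_right_cancel h
    · intro u hu
      split_ifs with hu'
      · exact ih u (lt_of_le_of_ne hu'.1 (Finset.ne_of_mem_erase hu).symm) hu'.2
      · rfl

/-- Möbius functions are compatible with embeddings of lower intervals whose image is closed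
upwards. -/
lemma mobius_map {b : α} {m : β} (f : {a : α // a ≤ b} → β) (hle : ∀ a a', f a ≤ f a' ↔ a ≤ a')
    (hm : f ⟨b, le_rfl⟩ = m) (hup : ∀ a s, f a ≤ s → s ≤ m → s ∈ Set.range f)
    (a : {a : α // a ≤ b}) : mobius (f a) m = mobius (a : α) b := by
  classical
  have hinj : Function.Injective f := fun a a' h =>
    le_antisymm ((hle _ _).1 h.le) ((hle _ _).1 h.ge)
  have hfm : ∀ a, f a ≤ m := fun a => hm ▸ (hle _ _).2 a.2
  -- The value zero off the lower interval is immaterial: the recursion only involves elements below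
  -- `b`.
  have := eq_mobius_of_sum (b := b) (fun a => if h : a ≤ b then mobius (f ⟨a, h⟩) m else 0) (by
    intro a ha
    have h := sum_mobius_left (f ⟨a, ha⟩) m
    have hab : f ⟨a, ha⟩ = m ↔ a = b := by
      rw [← hm, hinj.eq_iff, Subtype.mk.injEq]
    simp only [hab] at h
    -- Both recursions are rewritten as sums over the lower interval of `b`. No term in `β` is lost,
    -- because `hup` puts the whole interval from `f ⟨a, ha⟩` to `m` in the range of `f`.
    rw [← h, ← Fintype.sum_of_injective f hinj
      (fun u => if a ≤ u.1 then mobius (f u) m else 0) _ _ _]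
    · symm
      refine Fintype.sum_of_injective Subtype.val Subtype.val_injective _ _ ?_ ?_
      · intro u hu
        rw [if_neg]
        exact fun h => hu ⟨⟨u, h.2⟩, rfl⟩
      · intro u
        simp [u.2]
    · intro s hs
      rw [if_neg]
      exact fun h => hs (hup _ s h.1 h.2)
    · intro u
      have : f ⟨a, ha⟩ ≤ f u ↔ a ≤ u.1 := hle _ _
      simp [this, hfm u]) a.1 a.2
  rw [← this, dif_pos a.2]

end PosetMobius
-- Calculus of spans in `T⁰` and absorption by the idempotents
section Spans

lemma isPullback_of_mono {C : Type*} [Category C] {t i x : C} {f : t ⟶ x} {e : t ⟶ i} {m : i ⟶ x}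
    [Mono m] (h : e ≫ m = f) : IsPullback e (𝟙 t) m f := by
  simpa [h] using (IsPullback.id_vert e).paste_horiz (IsKernelPair.id_of_mono m)


variable {A : Type u} [Category.{v} A] [RegularCat A] {K : Type w} [CommRing K]
  (δ : DegreeFunction A K)

/-- The morphism `[x] ⟶ [y]` of `T⁰` given by a pair of morphisms `x ← t → y`. -/
noncomputable def T0.span {t x y : A} (f : t ⟶ x) (g : t ⟶ y) : T0.obj δ x ⟶ T0.obj δ y :=
  spanHom δ f g

lemma T0.span_comp {t t' x y z p₀ : A} {f : t ⟶ x} {g : t ⟶ y} {f' : t' ⟶ y} {g' : t' ⟶ z}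
    {p : p₀ ⟶ t} {q : p₀ ⟶ t'} (h : IsPullback p q g f') :
    T0.span δ f g ≫ T0.span δ f' g' = T0.span δ (p ≫ f) (q ≫ g') :=
  compHom_spanHom δ f g f' g' h

lemma T0.span_surj_comp {t t' x y : A} (e : t' ⟶ t) (he : Surj e) (f : t ⟶ x) (g : t ⟶ y) :
    T0.span δ (e ≫ f) (e ≫ g) = δ.deg e he • T0.span δ f g :=
  spanHom_precomp δ e he f g

lemma T0.map_eq_span {x y : A} (f : x ⟶ y) : T0.map δ f = T0.span δ (𝟙 x) f :=
  (spanHom_mono δ (graph f)).symm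

lemma T0.mapAdj_eq_span {x y : A} (f : x ⟶ y) : T0.mapAdj δ f = T0.span δ f (𝟙 x) :=
  (spanHom_mono δ (graphAdj f)).symm

lemma proj_eq_span {x : A} (u : Subobject x) : proj δ u = T0.span δ u.arrow u.arrow :=
  proj_eq_spanHom δ u

lemma proj_mk {x y : A} (f : y ⟶ x) [Mono f] : proj δ (Subobject.mk f) = T0.span δ f f :=
  (spanHom_eq_proj δ f).symm

lemma T0.map_comp_span {t x y z p₀ : A} (a : x ⟶ y) {f : t ⟶ y} {g : t ⟶ z} {p : p₀ ⟶ x}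
    {q : p₀ ⟶ t} (h : IsPullback p q a f) :
    T0.map δ a ≫ T0.span δ f g = T0.span δ p (q ≫ g) := by
  rw [T0.map_eq_span, T0.span_comp δ h, Category.comp_id]

lemma T0.span_comp_mapAdj {t x y z p₀ : A} (a : z ⟶ y) {f : t ⟶ x} {g : t ⟶ y} {p : p₀ ⟶ t}
    {q : p₀ ⟶ z} (h : IsPullback p q g a) :
    T0.span δ f g ≫ T0.mapAdj δ a = T0.span δ (p ≫ f) q := by
  rw [T0.mapAdj_eq_span, T0.span_comp δ h, Category.comp_id]

lemma T0.mapAdj_comp_span {t x y z : A} (a : y ⟶ x) (f : t ⟶ y) (g : t ⟶ z) :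
    T0.mapAdj δ a ≫ T0.span δ f g = T0.span δ (f ≫ a) g := by
  rw [T0.mapAdj_eq_span, T0.span_comp δ (IsPullback.id_horiz f).flip, Category.id_comp]

lemma T0.span_comp_map {t x y z : A} (f : t ⟶ x) (g : t ⟶ y) (a : y ⟶ z) :
    T0.span δ f g ≫ T0.map δ a = T0.span δ f (g ≫ a) := by
  rw [T0.map_eq_span, T0.span_comp δ (IsPullback.id_horiz g), Category.id_comp]

lemma T0.map_comp {x y z : A} (f : x ⟶ y) (g : y ⟶ z) :
    T0.map δ (f ≫ g) = T0.map δ f ≫ T0.map δ g := by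
  rw [T0.map_eq_span δ f, T0.span_comp_map, T0.map_eq_span]

lemma T0.mapAdj_comp {x y z : A} (f : x ⟶ y) (g : y ⟶ z) :
    T0.mapAdj δ (f ≫ g) = T0.mapAdj δ g ≫ T0.mapAdj δ f := by
  rw [T0.mapAdj_eq_span δ f, T0.mapAdj_comp_span, T0.mapAdj_eq_span]

lemma proj_comm {x : A} (u v : Subobject x) : proj δ u ≫ proj δ v = proj δ v ≫ proj δ u := by
  by_cases h : HasPullback u.arrow v.arrow
  · have hp := IsPullback.of_hasPullback u.arrow v.arrow
    rw [proj_eq_span, proj_eq_span, T0.span_comp δ hp, T0.span_comp δ hp.flip, hp.w]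
  · rw [proj_comp_zero δ u v h, proj_comp_zero δ v u]
    exact fun h' => h (IsPullback.of_hasPullback v.arrow u.arrow).flip.hasPullback

lemma Subobject.mk_ne_top_of_not_surj {t i x : A} {f : t ⟶ x} (hf : ¬ Surj f) {e : t ⟶ i}
    {m : i ⟶ x} [Mono m] (he : Surj e) (h : e ≫ m = f) : Subobject.mk m ≠ ⊤ := by
  intro hm
  have := (Subobject.isIso_iff_mk_eq_top m).2 hm
  exact hf (h ▸ he.comp (Surj.of_isIso m))

variable [SubobjectFinite A]

/-- The image of `f` is a proper subobject, and the span absorbs the corresponding idempotent, which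
`p_x^*` annihilates. -/
lemma pStar_comp_span {t x y : A} {f : t ⟶ x} (hf : ¬ Surj f) (g : t ⟶ y) :
    pStar δ x ≫ T0.span δ f g = 0 := by
  obtain ⟨i, e, m, he, hm, h⟩ := exists_factor f
  have hp : IsPullback e (𝟙 t) m f := isPullback_of_mono h
  have : T0.span δ f g = proj δ (Subobject.mk m) ≫ T0.span δ f g := by
    rw [proj_mk, T0.span_comp δ hp, h, Category.id_comp]
  rw [this, ← Category.assoc, pStar_comp_proj δ _ (Subobject.mk_ne_top_of_not_surj hf he h),
    zero_comp]

lemma proj_comp_pStar {x : A} (v : Subobject x) (hv : v ≠ ⊤) : proj δ v ≫ pStar δ x = 0 := by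
  have : Fintype (Subobject x) := Fintype.ofFinite _
  rw [← pStar_comp_proj δ v hv, pStar, finsum_eq_sum_of_fintype, Preadditive.sum_comp,
    Preadditive.comp_sum]
  exact Finset.sum_congr rfl fun u _ => by
    rw [Preadditive.comp_zsmul, Preadditive.zsmul_comp, proj_comm]

lemma span_comp_pStar {t x y : A} (f : t ⟶ x) {g : t ⟶ y} (hg : ¬ Surj g) :
    T0.span δ f g ≫ pStar δ y = 0 := by
  obtain ⟨i, e, m, he, hm, h⟩ := exists_factor g
  have hp : IsPullback (𝟙 t) e g m := (isPullback_of_mono h).flip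
  have : T0.span δ f g = T0.span δ f g ≫ proj δ (Subobject.mk m) := by
    rw [proj_mk, T0.span_comp δ hp, h, Category.id_comp]
  rw [this, Category.assoc, proj_comp_pStar δ _ (Subobject.mk_ne_top_of_not_surj hg he h),
    comp_zero]

/-- Pulling `f` back along the surjection `a` cannot make it surjective: otherwise the diagonal of
the pullback square would be surjective, and with it `f`, its last factor. -/
lemma pStar_comp_map_comp_span {t x y z : A} {a : x ⟶ y} (ha : Surj a) {f : t ⟶ y}
    (hf : ¬ Surj f) (g : t ⟶ z) : pStar δ x ≫ T0.map δ a ≫ T0.span δ f g = 0 := by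
  obtain ⟨r, p, q, h, -⟩ := RegularCat.surj_pullback a f ha
  rw [T0.map_comp_span δ a h]
  refine pStar_comp_span δ (fun hp => hf ?_) _
  have := hp.comp ha
  rw [h.w] at this
  exact this.of_comp

lemma span_comp_mapAdj_comp_pStar {t x y z : A} {a : z ⟶ y} (ha : Surj a) (f : t ⟶ x)
    {g : t ⟶ y} (hg : ¬ Surj g) : T0.span δ f g ≫ T0.mapAdj δ a ≫ pStar δ z = 0 := by
  obtain ⟨r, q, p, h, -⟩ := RegularCat.surj_pullback a g ha
  rw [← Category.assoc, T0.span_comp_mapAdj δ a h.flip]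
  refine span_comp_pStar δ _ (fun hp => hg ?_)
  have := hp.comp ha
  rw [h.w] at this
  exact this.of_comp

/-- Only the summand of `⊤` in `p_x^*` survives, and that summand is the identity. -/
lemma comp_pStar_eq_self {X : T0 δ} {x : A} (φ : X ⟶ T0.obj δ x)
    (h : ∀ v : Subobject x, v ≠ ⊤ → φ ≫ proj δ v = 0) : φ ≫ pStar δ x = φ := by
  have : Fintype (Subobject x) := Fintype.ofFinite _
  rw [pStar, finsum_eq_sum_of_fintype, Preadditive.comp_sum, Finset.sum_eq_single ⊤]
  · rw [Preadditive.comp_zsmul, mobius_self, one_smul, proj_top, Category.comp_id]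
  · intro v _ hv
    rw [Preadditive.comp_zsmul, h v hv, smul_zero]
  · simp

/-- The endomorphism `[e] p_x^* [e]^∨` of `[y]` is `ω_e p_y^*`. -/
lemma mapAdj_pStar_map {x y : A} {e : x ⟶ y} (he : Surj e) :
    T0.mapAdj δ e ≫ pStar δ x ≫ T0.map δ e = omega δ e • pStar δ y := by
  classical
  have : Fintype (Subobject x) := Fintype.ofFinite _
  have h1 : T0.mapAdj δ e ≫ pStar δ x ≫ T0.map δ e =
      ∑ s : Subobject x, mobius s ⊤ • T0.span δ (s.arrow ≫ e) (s.arrow ≫ e) := by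
    rw [pStar, finsum_eq_sum_of_fintype, Preadditive.sum_comp, Preadditive.comp_sum]
    refine Finset.sum_congr rfl fun s _ => ?_
    rw [Preadditive.zsmul_comp, Preadditive.comp_zsmul, proj_eq_span, T0.span_comp_map,
      T0.mapAdj_comp_span]
  -- A factor `p_y^*` may be inserted for free, since a proper subobject `v` of `y` has a
  -- non-surjective inclusion. This factor then discards the `s` that do not map onto `y`; each
  -- other `s` contributes `δ(s ↠ y)` times the identity.
  have h2 : (T0.mapAdj δ e ≫ pStar δ x ≫ T0.map δ e) ≫ pStar δ y =
      T0.mapAdj δ e ≫ pStar δ x ≫ T0.map δ e := by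
    refine comp_pStar_eq_self δ _ fun v hv => ?_
    rw [Category.assoc, Category.assoc, proj_eq_span, pStar_comp_map_comp_span δ he, comp_zero]
    intro h
    exact hv ((Subobject.isIso_arrow_iff_eq_top v).1 (h (𝟙 _) v.arrow (by simp)))
  rw [← h2, h1, Preadditive.sum_comp, omega, finsum_eq_sum_of_fintype, Finset.sum_smul]
  refine Finset.sum_congr rfl fun s _ => ?_
  rw [Preadditive.zsmul_comp]
  split_ifs with h
  · have := T0.span_surj_comp δ _ h (𝟙 y) (𝟙 y)
    rw [Category.comp_id, ← T0.map_eq_span] at this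
    have h' : T0.map δ (𝟙 y) = 𝟙 (T0.obj δ y) := rfl
    rw [this, h', Linear.smul_comp, Category.id_comp, smul_assoc]
  · rw [span_comp_pStar δ _ h, smul_zero, zero_smul]

end Spans
-- Relations contained in a given relation
section Restrict

variable {A : Type u} [Category.{v} A]

lemma Corel.rep_le_iff {x y : A} {t : Corel x y} {w : Cospan A x y} :
    t.rep ≤ w ↔ t ≤ w.toCorel := by
  conv_rhs => rw [← toAntisymmetrization_ofAntisymmetrization (· ≤ ·) t]
  exact Iff.rfl

lemma Corel.le_rep_iff {x y : A} {t : Corel x y} {w : Cospan A x y} :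
    w ≤ t.rep ↔ w.toCorel ≤ t := by
  conv_rhs => rw [← toAntisymmetrization_ofAntisymmetrization (· ≤ ·) t]
  exact Iff.rfl

/-- The relations contained in a relation `r` are the subobjects of `r`. -/
noncomputable def MonoSpan.restrict {x y : A} (r : MonoSpan A x y) (s : Subobject r.obj) :
    MonoSpan A x y where
  obj := (s : A)
  fst := s.arrow ≫ r.fst
  snd := s.arrow ≫ r.snd
  jm t f g h1 h2 := (cancel_mono s.arrow).1 (r.jm _ _ (by simpa using h1) (by simpa using h2))

lemma MonoSpan.restrict_le {x y : A} (r : MonoSpan A x y) (s : Subobject r.obj) :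
    r.restrict s ≤ r := ⟨s.arrow, rfl, rfl⟩

lemma MonoSpan.restrict_le_restrict_iff {x y : A} {r : MonoSpan A x y} {s s' : Subobject r.obj} :
    r.restrict s ≤ r.restrict s' ↔ s ≤ s' := by
  constructor
  · rintro ⟨h, h1, h2⟩
    exact Subobject.le_of_comm h (r.jm _ _ ((Category.assoc _ _ _).trans h1)
      ((Category.assoc _ _ _).trans h2))
  · intro h
    exact ⟨Subobject.ofLE s s' h, by simp [restrict], by simp [restrict]⟩

lemma MonoSpan.exists_restrict {x y : A} {r s : MonoSpan A x y} (h : s ≤ r) :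
    ∃ m : Subobject r.obj, r.restrict m ≤ s ∧ s ≤ r.restrict m := by
  obtain ⟨h, h1, h2⟩ := h
  have : Mono h := ⟨fun f g e => s.jm _ _ (by rw [← h1, ← Category.assoc, e, Category.assoc])
    (by rw [← h2, ← Category.assoc, e, Category.assoc])⟩
  refine ⟨Subobject.mk h, ⟨(Subobject.underlyingIso h).hom, ?_, ?_⟩,
    ⟨(Subobject.underlyingIso h).inv, ?_, ?_⟩⟩ <;> simp [restrict, ← h1, ← h2]

lemma MonoSpan.isPullback_of_le_of_le {x y z : A} {r s : MonoSpan A x y} (h : r ≤ s) (h' : s ≤ r)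
    {a : x ⟶ z} {b : y ⟶ z} (hr : IsPullback r.fst r.snd a b) :
    IsPullback s.fst s.snd a b := by
  obtain ⟨h, h1, h2⟩ := h
  obtain ⟨k, k1, k2⟩ := h'
  have hkl : h ≫ k = 𝟙 _ := r.jm _ _ (by simp [*]) (by simp [*])
  have hlk : k ≫ h = 𝟙 _ := s.jm _ _ (by simp [*]) (by simp [*])
  exact hr.of_iso ⟨h, k, hkl, hlk⟩ (Iso.refl _) (Iso.refl _) (Iso.refl _) (by simp [h1])
    (by simp [h2]) (by simp) (by simp)

end Restrict

/-! ### Co-relations below the pushout as subobjects -/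

section Product

variable {A : Type u} [Category.{v} A] [RegularCat A]

/-- The fibre product of a co-relation, as a relation. -/
noncomputable def Cospan.fiberProduct {x y : A} (u : Cospan A x y) : MonoSpan A x y :=
  u.exists_fiberProduct.choose

lemma Cospan.isPullback_fiberProduct {x y : A} (u : Cospan A x y) :
    IsPullback u.fiberProduct.fst u.fiberProduct.snd u.left u.right :=
  u.exists_fiberProduct.choose_spec

/-- A cospan of surjections is recovered from its fibre product, since surjections are quotients by
their kernel pairs. The order of co-relations can thus be read off inside a poset of subobjects. -/
lemma Cospan.fiberProduct_le_iff {x y : A} {u v : Cospan A x y} {r s : MonoSpan A x y}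
    (hr : IsPullback r.fst r.snd u.left u.right) (hs : IsPullback s.fst s.snd v.left v.right) :
    r ≤ s ↔ u ≤ v := by
  refine ⟨Cospan.le_of_fiberProduct_le hr hs, ?_⟩
  rintro ⟨h, h1, h2⟩
  exact ⟨hs.lift r.fst r.snd (by rw [← h1, ← h2, ← Category.assoc, hr.w, Category.assoc]),
    by simp, by simp⟩

/-- If `r` is the fibre product of `w`, then the co-relations below `w` are the subobjects of `r`
with surjective projections. -/
lemma exists_subobject_embedding [ExactCat A] [Maltsev A] {x y : A} {r : MonoSpan A x y}
    {w : Cospan A x y} (hr : IsPullback r.fst r.snd w.left w.right) :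
    ∃ f : {t : Corel x y // t ≤ w.toCorel} → Subobject r.obj,
      (∀ t t', f t ≤ f t' ↔ t ≤ t') ∧ f ⟨w.toCorel, le_rfl⟩ = ⊤ ∧
      (∀ s, s ∈ Set.range f ↔ Surj (s.arrow ≫ r.fst) ∧ Surj (s.arrow ≫ r.snd)) ∧
      ∀ t, IsPullback ((f t).arrow ≫ r.fst) ((f t).arrow ≫ r.snd) t.1.rep.left t.1.rep.right := by
  have hle : ∀ t : {t : Corel x y // t ≤ w.toCorel}, t.1.rep.fiberProduct ≤ r := fun t =>
    (Cospan.fiberProduct_le_iff (Cospan.isPullback_fiberProduct _) hr).2 (Corel.rep_le_iff.2 t.2)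
  choose f hf hf' using fun t => MonoSpan.exists_restrict (hle t)
  have hp : ∀ t, IsPullback (r.restrict (f t)).fst (r.restrict (f t)).snd
      t.1.rep.left t.1.rep.right := fun t =>
    MonoSpan.isPullback_of_le_of_le (hf' t) (hf t) (Cospan.isPullback_fiberProduct _)
  have hmono : ∀ t t', f t ≤ f t' ↔ t ≤ t' := by
    intro t t'
    rw [← MonoSpan.restrict_le_restrict_iff, ← Subtype.coe_le_coe,
      ← ofAntisymmetrization_le_ofAntisymmetrization_iff]
    change _ ↔ t.1.rep ≤ t'.1.rep
    exact Cospan.fiberProduct_le_iff (hp t) (hp t')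
  refine ⟨f, hmono, ?_, ?_, hp⟩
  · rw [eq_top_iff, ← MonoSpan.restrict_le_restrict_iff]
    exact (r.restrict_le _).trans
      ((Cospan.fiberProduct_le_iff hr (hp _)).2 (Corel.le_rep_iff.2 le_rfl))
  · intro s
    constructor
    · rintro ⟨t, rfl⟩
      exact ⟨Surj.of_isPullback (hp t).flip t.1.rep.surj_right,
        Surj.of_isPullback (hp t) t.1.rep.surj_left⟩
    · rintro ⟨h1, h2⟩
      -- The preimage of `s` is its pushout `t`; exactness and the Mal'tsev property enter here, to
      -- make `s` the fibre product over `t`.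
      obtain ⟨t, ht, -⟩ := (r.restrict s).exists_pushout h1 h2
      have htw : t ≤ w := Cospan.le_of_fiberProduct_le ht hr (r.restrict_le s)
      refine ⟨⟨t.toCorel, htw⟩, le_antisymm ?_ ?_⟩ <;> rw [← MonoSpan.restrict_le_restrict_iff]
      · exact (Cospan.fiberProduct_le_iff (hp _) ht).2 (Corel.rep_le_iff.2 le_rfl)
      · exact (Cospan.fiberProduct_le_iff ht (hp _)).2 (Corel.le_rep_iff.2 le_rfl)

/-! ### The product of two morphisms `{u}'` and `{v}'` -/

section Composition

variable [SubobjectFinite A] {K : Type w} [CommRing K] (δ : DegreeFunction A K)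

/-- Both legs factor through `e`, so the middle of the composite is `[e] p_y^* [e]^∨`, a multiple of
the idempotent of `r.obj`; the sum is the expansion of that idempotent. -/
lemma mapAdj_pStar_map_eq_sum [∀ x : A, Fintype (Subobject x)] {x y z : A} {b : y ⟶ x}
    {c : y ⟶ z} {r : MonoSpan A x z} {e : y ⟶ r.obj} (he : Surj e) (hb : e ≫ r.fst = b)
    (hc : e ≫ r.snd = c) :
    T0.mapAdj δ b ≫ pStar δ y ≫ T0.map δ c =
      omega δ e • ∑ s : Subobject r.obj,
        mobius s ⊤ • T0.span δ (s.arrow ≫ r.fst) (s.arrow ≫ r.snd) := by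
  have h : T0.mapAdj δ b ≫ pStar δ y ≫ T0.map δ c =
      T0.mapAdj δ r.fst ≫ (T0.mapAdj δ e ≫ pStar δ y ≫ T0.map δ e) ≫ T0.map δ r.snd := by
    rw [← hb, ← hc, T0.mapAdj_comp, T0.map_comp]
    simp only [Category.assoc]
  rw [h, mapAdj_pStar_map δ he, Linear.smul_comp, Linear.comp_smul, pStar,
    finsum_eq_sum_of_fintype, Preadditive.sum_comp, Preadditive.comp_sum]
  congr 1
  refine Finset.sum_congr rfl fun s _ => ?_
  rw [Preadditive.zsmul_comp, Preadditive.comp_zsmul, proj_eq_span, T0.span_comp_map,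
    T0.mapAdj_comp_span]

lemma corelHomT0_extend {x z u v r : A} {a : x ⟶ u} {d : z ⟶ v} (ha : Surj a) (hd : Surj d)
    (t : Cospan A u v) {p : r ⟶ u} {q : r ⟶ v} (h : IsPullback p q t.left t.right) :
    corelHomT0 δ (t.extend a d ha hd) =
      pStar δ x ≫ T0.map δ a ≫ T0.span δ p q ≫ T0.mapAdj δ d ≫ pStar δ z := by
  have h' : T0.map δ t.left ≫ T0.mapAdj δ t.right = T0.span δ p q := map_comp_mapAdj δ h
  rw [← h']
  simp only [corelHomT0, Cospan.extend, T0.map_comp, T0.mapAdj_comp, Category.assoc]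

lemma corelHomT0_comp [ExactCat A] [Maltsev A] {x y z : A} (u : Cospan A x y) (v : Cospan A y z)
    {r : MonoSpan A u.obj v.obj} {e : y ⟶ r.obj} (he : Surj e) (hb : e ≫ r.fst = u.right)
    (hc : e ≫ r.snd = v.left) {w : Cospan A u.obj v.obj}
    (hw : IsPullback r.fst r.snd w.left w.right)
    [Fintype {t : Corel u.obj v.obj // t ≤ w.toCorel}] :
    corelHomT0 δ u ≫ corelHomT0 δ v =
      omega δ e • ∑ t : {t : Corel u.obj v.obj // t ≤ w.toCorel},
        mobius (t : Corel u.obj v.obj) w.toCorel •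
          corelHomT0 δ (t.1.rep.extend u.left v.right u.surj_left v.surj_right) := by
  have hfin : ∀ x : A, Fintype (Subobject x) := fun x => Fintype.ofFinite _
  have : Fintype (Corel u.obj v.obj) := Fintype.ofFinite _
  obtain ⟨f, hmono, htop, hrange, hp⟩ := exists_subobject_embedding hw
  have h1 : corelHomT0 δ u ≫ corelHomT0 δ v =
      pStar δ x ≫ T0.map δ u.left ≫ (T0.mapAdj δ u.right ≫ pStar δ y ≫ T0.map δ v.left) ≫
        T0.mapAdj δ v.right ≫ pStar δ z := by
    have h2 := (pStar_idem δ y) =≫ (T0.map δ v.left ≫ T0.mapAdj δ v.right ≫ pStar δ z)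
    simp only [Category.assoc] at h2
    simp only [corelHomT0, Category.assoc, h2]
  rw [h1, mapAdj_pStar_map_eq_sum δ he hb hc]
  simp only [Linear.smul_comp, Linear.comp_smul, Preadditive.sum_comp, Preadditive.comp_sum]
  congr 1
  symm
  -- The sum over co-relations is compared along `f` with the sum over all subobjects of `r.obj`;
  -- those outside the range of `f` miss `u` or `v` and are killed by an outer idempotent.
  refine Fintype.sum_of_injective f (fun t t' h => le_antisymm ((hmono _ _).1 h.le)
    ((hmono _ _).1 h.ge)) _ _ ?_ ?_
  · intro s hs
    rw [hrange, not_and_or] at hs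
    rcases hs with hs | hs
    · have := pStar_comp_map_comp_span δ u.surj_left hs (s.arrow ≫ r.snd) =≫
        (T0.mapAdj δ v.right ≫ pStar δ z)
      simp only [Category.assoc, zero_comp] at this
      rw [this, smul_zero]
    · rw [span_comp_mapAdj_comp_pStar δ v.surj_right _ hs, comp_zero, comp_zero, smul_zero]
  · intro t
    rw [mobius_map f hmono htop (fun a s h _ => ?_) t, corelHomT0_extend δ _ _ _ (hp t)]
    -- The range of `f` is closed upwards: a subobject containing one with surjective projections
    -- has surjective projections too.
    obtain ⟨h2, h3⟩ := (hrange _).1 ⟨a, rfl⟩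
    have hs := Subobject.ofLE_arrow h
    refine (hrange s).2 ⟨?_, ?_⟩
    · rw [← hs, Category.assoc] at h2
      exact h2.of_comp
    · rw [← hs, Category.assoc] at h3
      exact h3.of_comp

end Composition

/-- As `e` is an epimorphism, both spans have the same cocones. The pushout under the image of `y`
is therefore the pushout under `y` itself. -/
lemma Surj.isPushout_comp {x y z w t : A} {e : t ⟶ x} (he : Surj e) {p : x ⟶ y} {q : x ⟶ z}
    {a : y ⟶ w} {b : z ⟶ w} (h : IsPushout p q a b) : IsPushout (e ≫ p) (e ≫ q) a b := by
  have := he.epi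
  have hd : ∀ s : PushoutCocone (e ≫ p) (e ≫ q), p ≫ s.inl = q ≫ s.inr := fun s => by
    rw [← cancel_epi e]
    simpa using s.condition
  exact ⟨⟨by rw [Category.assoc, h.w, Category.assoc]⟩,
    ⟨PushoutCocone.IsColimit.mk _ (fun s => h.desc s.inl s.inr (hd s)) (by simp) (by simp)
      fun s m h1 h2 => h.hom_ext (by simp [h1]) (by simp [h2])⟩⟩

end Product
end TensorEnvelope

open TensorEnvelope in
theorem mainTheorem3 {A : Type u} [Category.{v} A] [RegularCat A] [ExactCat A] [Maltsev A]
    [SubobjectFinite A] {K : Type w} [CommRing K] (δ : DegreeFunction A K)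
    {x y z : A} (u : Cospan A x y) (v : Cospan A y z) :
    ∃ w : Cospan A u.obj v.obj,
      IsPushout u.right v.left w.left w.right ∧
      IsPullback (spanImage u.right v.left).fst (spanImage u.right v.left).snd w.left w.right ∧
      corelHom δ u ≫ corelHom δ v =
        omega δ (toSpanImage u.right v.left) •
          ∑ᶠ (t : Corel u.obj v.obj) (_ : t ≤ w.toCorel),
            mobius t w.toCorel •
              corelHom δ (t.rep.extend u.left v.right u.surj_left v.surj_right) := by
  have he := toSpanImage_surj u.right v.left
  have hb := toSpanImage_fst u.right v.left
  have hc := toSpanImage_snd u.right v.left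
  -- The projections of the image are surjective, being last factors of the surjective legs
  -- `u.right` and `v.left`.
  obtain ⟨w, hw, hw'⟩ := (spanImage u.right v.left).exists_pushout
    (Surj.of_comp (hb.symm.subst (motive := Surj) u.surj_right))
    (Surj.of_comp (hc.symm.subst (motive := Surj) v.surj_left))
  have hpo := he.isPushout_comp hw'
  rw [hb, hc] at hpo
  refine ⟨w, hpo, hw, Idempotents.Karoubi.hom_ext _ _ ?_⟩
  have : Fintype {t : Corel u.obj v.obj // t ≤ w.toCorel} := Fintype.ofFinite _
  rw [← finsum_subtype_eq_finsum_cond (p := (· ≤ w.toCorel)), finsum_eq_sum_of_fintype,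
    karoubi_smul_f, Idempotents.Karoubi.sum_hom]
  refine (corelHomT0_comp δ u v he hb hc hw).trans (congrArg _ (Finset.sum_congr rfl fun t _ => ?_))
  exact (Idempotents.Karoubi.zsmul_hom _ (corelHom δ _)).symm
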